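/- Let $d\ge 0$ be an integer, let $g:\mathbb{R}^d\to\mathbb{R}^d$, and put $h(x)=x-g(x)$; $\|\cdot\|$ is the Euclidean norm. **Assumption.** (i) $h(x^*)=0$; (ii) $h$ is differentiable with Lipschitz continuous Jacobian $h'$ in a neighbourhood of $x^*$; (iii) $h'(x^*)$, which need not be symmetric, is positive definite, i.e. $y^{\mathrm T}h'(x^*)y>0$ for all $y\neq 0$. **Process I (restarted Anderson mixing, Type-I or Type-II).** Parameters: an integer $m\ge 1$, $\tau\in(0,1)$, $\eta>0$, and real numbers $\beta_k$ with $\beta\le|\beta_k|\le\beta'$, where $\beta,\beta'>0$. Throughout, $v_j:=p_j$ for Type-I and $v_j:=q_j$ for Type-II. Start from $x_0$ with $m_0=0$. In iteration $k=0,1,2,\dots$ (no stopping test; a quotient with denominator $0$ is read as $0$): 1. Put $r_k=g(x_k)-x_k$. If $m_k>m$ or $\|r_k\|>\eta\|r_{k-m_k}\|$, set $m_k=0$. 2. If $m_k>0$: start from $p_k=x_k-x_{k-1}$, $q_k=r_k-r_{k-1}$; for $j=1,\dots,m_k-1$ in turn put $\zeta=(v_{k-m_k+j}^{\mathrm T}q_k)/(v_{k-m_k+j}^{\mathrm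 T}q_{k-m_k+j})$ and replace $p_k$ by $p_k-\zeta p_{k-m_k+j}$ and $q_k$ by $q_k-\zeta q_{k-m_k+j}$. If then $|v_k^{\mathrm T}q_k|<\tau|v_{k-m_k+1}^{\mathrm T}q_{k-m_k+1}|$, set $m_k=0$. 3. Start from $\bar x_k=x_k$, $\bar r_k=r_k$; for $j=1,\dots,m_k$ in turn put $\gamma=(v_{k-m_k+j}^{\mathrm T}\bar r_k)/(v_{k-m_k+j}^{\mathrm T}q_{k-m_k+j})$ and replace $\bar x_k$ by $\bar x_k-\gamma p_{k-m_k+j}$ and $\bar r_k$ by $\bar r_k-\gamma q_{k-m_k+j}$. 4. Put $x_{k+1}=\bar x_k+\beta_k\bar r_k$ and $m_{k+1}=m_k+1$. Below, $m_k$ denotes the final value of $m_k$ in iteration $k$ (the one used in steps 3 and 4). **Process II.** Let $\hat h(x)=h'(x^*)(x-x^*)$. With the type, the $m_k$ and the $\beta_k$ of Process I, iteration $k$ starts at a point $\hat x_k$ and produces a point $\hat x_{k+1}^{+}$. Here $\hat x_k=x_k$ if $m_k=0$ (restart), and $\hat x_k=\hat x_k^{+}$ if $m_k>0$. Put $\hat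 r_k=-\hat h(\hat x_k)$, and $\hat v_j=\hat p_j$ (Type-I) or $\hat v_j=\hat q_j$ (Type-II). If $m_k>0$, then $$\hat p_k=\hat x_k-\hat x_{k-1}-\sum_{j=1}^{m_k-1}\hat\zeta_k^{(j)}\hat p_{k-m_k+j},\qquad \hat q_k=\hat r_k-\hat r_{k-1}-\sum_{j=1}^{m_k-1}\hat\zeta_k^{(j)}\hat q_{k-m_k+j},$$ where the numbers $\hat\zeta_k^{(j)}$ are such that $\hat q_k\perp \hat v_{k-m_k+j}$ for $1\le j\le m_k-1$. For every $k$, $$\hat x_{k+1}^{+}=\hat x_k+\beta_k\hat r_k-\sum_{j=1}^{m_k}\hat\Gamma_k^{(j)}\bigl(\hat p_{k-m_k+j}+\beta_k\hat q_{k-m_k+j}\bigr),$$ where the numbers $\hat\Gamma_k^{(j)}$ are such that $\hat r_k-\sum_{j=1}^{m_k}\hat\Gamma_k^{(j)}\hat q_{k-m_k+j}\perp\hat v_{k-m_k+i}$ for $1\le i\le m_k$. **Constants.** Under the Assumption there are positive constants $\hat\rho,\hat\kappa,\mu,L$ such that $h$ is differentiable at each $x$ with $\|x-x^*\|\le\hat\rho$,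 and for all such $x$ and all $y\in\mathbb{R}^d$ $$\mu\|y\|\le\|h'(x)y\|\le L\|y\|,\quad \mu\|y\|^2\le y^{\mathrm T}h'(x)y\le L\|y\|^2,\quad \|h(x)-h'(x^*)(x-x^*)\|\le\tfrac12\hat\kappa\|x-x^*\|^2.\qquad(*)$$ **Lemma.** Let $\eta_0>0$. The constants $\hat\rho,\hat\kappa,\mu,L$ just described exist. Moreover, for all $\mu,L>0$ there is a constant $C>0$, depending only on $d$, the type, $m,\tau,\eta,\beta,\beta',\eta_0,\mu,L$ (in particular neither on $\hat\kappa$ nor on $k$), and for all $\hat\rho,\hat\kappa>0$ there is $\delta>0$, depending only on these data and on $\hat\rho,\hat\kappa$, such that the following holds for every $g$ and $x^*$ that satisfy the Assumption and $(*)$ with these constants, for all $\beta_k$ as above, and for every run of Process I with $\|x_0-x^*\|\le\delta$. If $k\ge 0$ and $\|h(x_j)\|\le\eta_0\|h(x_0)\|$ for $j=0,\dots,k$, then Process II can be carried out for the iterations $0,\dots,k$, and, however the numbers $\hat\zeta$ and $\hat\Gamma$ are chosen where they are not unique, $$\|r_k-\hat r_k\|\le C\,\hat\kappa\,\|x_{k-m_k}-x^*\|^2,\qquad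 \|x_{k+1}-\hat x_{k+1}^{+}\|\le C\,\hat\kappa\,\|x_{k-m_k}-x^*\|^2 .$$ -/

import Mathlib

noncomputable section

namespace RestartedAM

/-- The space `ℝ^d` with the Euclidean norm and inner product. -/
abbrev Vec (d : ℕ) := EuclideanSpace ℝ (Fin d)

/-- The two variants of Anderson mixing. -/
inductive AMType where
  | typeI
  | typeII

/-- The vectors `v_j`: `v_j = p_j` for Type-I and `v_j = q_j` for Type-II. -/
def AMType.dir {d : ℕ} (ty : AMType) (p q : ℕ → Vec d) : ℕ → Vec d :=
  match ty with
  | AMType.typeI => p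
  | AMType.typeII => q

/-- `h(x) = x - g(x)`. -/
def hfun {d : ℕ} (g : Vec d → Vec d) (x : Vec d) : Vec d := x - g x

/-- The residual `r(x) = g(x) - x`. -/
def resid {d : ℕ} (g : Vec d → Vec d) (x : Vec d) : Vec d := g x - x

/-- The assumption on the fixed-point problem: `xs` is a zero of `h = id - g`, `h` is
Lipschitz continuously differentiable in a neighbourhood of `xs`, and the (not necessarily
symmetric) Jacobian `h'(xs)` is positive definite. -/
structure Assumption {d : ℕ} (g : Vec d → Vec d) (xs : Vec d) : Prop where
  zero : hfun g xs = 0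
  smooth : ∃ U ∈ nhds xs, ∃ K : NNReal,
    (∀ x ∈ U, DifferentiableAt ℝ (hfun g) x) ∧ LipschitzOnWith K (fderiv ℝ (hfun g)) U
  posDef : ∀ y : Vec d, y ≠ 0 → 0 < inner ℝ y (fderiv ℝ (hfun g) xs y)

/-- The constants `ρ, κ, μ, L` are positive and satisfy the local estimates for `h` and its
Jacobian on the closed ball of radius `ρ` around `xs`. -/
structure LocalConstants {d : ℕ} (g : Vec d → Vec d) (xs : Vec d) (ρ κ μ L : ℝ) : Prop where
  rho_pos : 0 < ρ
  kappa_pos : 0 < κ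
  mu_pos : 0 < μ
  L_pos : 0 < L
  diff : ∀ x ∈ Metric.closedBall xs ρ, DifferentiableAt ℝ (hfun g) x
  jac_lower : ∀ x ∈ Metric.closedBall xs ρ, ∀ y : Vec d, μ * ‖y‖ ≤ ‖fderiv ℝ (hfun g) x y‖
  jac_upper : ∀ x ∈ Metric.closedBall xs ρ, ∀ y : Vec d, ‖fderiv ℝ (hfun g) x y‖ ≤ L * ‖y‖
  quad_lower : ∀ x ∈ Metric.closedBall xs ρ, ∀ y : Vec d,
    μ * ‖y‖ ^ 2 ≤ inner ℝ y (fderiv ℝ (hfun g) x y)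
  quad_upper : ∀ x ∈ Metric.closedBall xs ρ, ∀ y : Vec d,
    inner ℝ y (fderiv ℝ (hfun g) x y) ≤ L * ‖y‖ ^ 2
  taylor : ∀ x ∈ Metric.closedBall xs ρ,
    ‖hfun g x - fderiv ℝ (hfun g) xs (x - xs)‖ ≤ 1 / 2 * κ * ‖x - xs‖ ^ 2

/-- The inner loop of the algorithm. Starting from `(a, b)`, for `i = s+1, s+2, …, s+j` in turn,
put `γ = ⟪v_i, b⟫ / ⟪v_i, q_i⟫` and replace `(a, b)` by `(a - γ p_i, b - γ q_i)`. -/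
def sweep {d : ℕ} (v p q : ℕ → Vec d) (s : ℕ) (a b : Vec d) : ℕ → Vec d × Vec d
  | 0 => (a, b)
  | j + 1 =>
    let w := sweep v p q s a b j
    let γ : ℝ := inner ℝ (v (s + j + 1)) w.2 / inner ℝ (v (s + j + 1)) (q (s + j + 1))
    (w.1 - γ • p (s + j + 1), w.2 - γ • q (s + j + 1))

/-- The value of `m_k` on entering iteration `k`, before the restarting conditions are tested:
`0` for `k = 0`, and `m_{k-1} + 1` otherwise. -/
def enterLen (m : ℕ → ℕ) : ℕ → ℕ
  | 0 => 0
  | k + 1 => m k + 1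

open Classical in
/-- Process I: a run of restarted Anderson mixing for `x = g(x)` with memory bound `mem`,
restarting parameters `τ, η` and mixing parameters `β_k`, without a stopping test.

`n k` is the value of `m_k` after the tests on the memory and on the residual, and
`m k` is its final value, after the test on `|⟪v_k, q_k⟫|` too. -/
structure ProcessI {d : ℕ} (ty : AMType) (g : Vec d → Vec d) (mem : ℕ) (τ η : ℝ)
    (β : ℕ → ℝ) where
  x : ℕ → Vec d
  p : ℕ → Vec d
  q : ℕ → Vec d
  n : ℕ → ℕ
  m : ℕ → ℕ
  n_eq : ∀ k, n k =
    if mem < enterLen m k ∨ η * ‖resid g (x (k - enterLen m k))‖ < ‖resid g (x k)‖ then 0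
    else enterLen m k
  pair_eq : ∀ k, 0 < n k → (p k, q k) =
    sweep (ty.dir p q) p q (k - n k) (x k - x (k - 1)) (resid g (x k) - resid g (x (k - 1)))
      (n k - 1)
  m_eq : ∀ k, m k =
    if 0 < n k ∧ |inner ℝ (ty.dir p q k) (q k)| <
        τ * |inner ℝ (ty.dir p q (k - n k + 1)) (q (k - n k + 1))| then 0
    else n k
  x_succ : ∀ k, x (k + 1) =
    (sweep (ty.dir p q) p q (k - m k) (x k) (resid g (x k)) (m k)).1 +
      β k • (sweep (ty.dir p q) p q (k - m k) (x k) (resid g (x k)) (m k)).2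

/-- The residual `-ĥ(z)` of the linear model `ĥ(z) = h'(xs)(z - xs)`. -/
def linResid {d : ℕ} (g : Vec d → Vec d) (xs z : Vec d) : Vec d :=
  -(fderiv ℝ (hfun g) xs (z - xs))

/-- Process II, carried out for the iterations `0, …, N`: between successive restarts of the
run `R` of Process I, full-memory Anderson mixing of the same type with modified historical
sequences for `ĥ(x) = 0`, with the same `m_k` and `β_k`.

At a restart index `k` the iterate that iteration `k - 1` has produced is replaced by `x_k`, so
two names are needed: `out (k + 1)` is the iterate that iteration `k` produces, and `xh k` is the
iterate at which iteration `k` starts, that is `x_k` if `m_k = 0`, and `out k` otherwise. -/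
structure ProcessII {d : ℕ} {ty : AMType} {g : Vec d → Vec d} {mem : ℕ} {τ η : ℝ} {β : ℕ → ℝ}
    (R : ProcessI ty g mem τ η β) (xs : Vec d) (N : ℕ) where
  xh : ℕ → Vec d
  out : ℕ → Vec d
  ph : ℕ → Vec d
  qh : ℕ → Vec d
  xh_restart : ∀ k ≤ N, R.m k = 0 → xh k = R.x k
  xh_continue : ∀ k ≤ N, 0 < R.m k → xh k = out k
  pair : ∀ k ≤ N, 0 < R.m k → ∃ ζ : ℕ → ℝ,
    ph k = (xh k - xh (k - 1)) -
      ∑ j ∈ Finset.Icc 1 (R.m k - 1), ζ j • ph (k - R.m k + j) ∧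
    qh k = (linResid g xs (xh k) - linResid g xs (xh (k - 1))) -
      ∑ j ∈ Finset.Icc 1 (R.m k - 1), ζ j • qh (k - R.m k + j) ∧
    ∀ j ∈ Finset.Icc 1 (R.m k - 1), inner ℝ (ty.dir ph qh (k - R.m k + j)) (qh k) = 0
  step : ∀ k ≤ N, ∃ Γ : ℕ → ℝ,
    (∀ i ∈ Finset.Icc 1 (R.m k), inner ℝ (ty.dir ph qh (k - R.m k + i))
      (linResid g xs (xh k) -
        ∑ j ∈ Finset.Icc 1 (R.m k), Γ j • qh (k - R.m k + j)) = 0) ∧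
    out (k + 1) = xh k + β k • linResid g xs (xh k) -
      ∑ j ∈ Finset.Icc 1 (R.m k), Γ j • (ph (k - R.m k + j) + β k • qh (k - R.m k + j))

end RestartedAM

end

noncomputable section
namespace RestartedAM

/-! Let e be the distance from x* of the last restart point x_{k-m_k}, and ε = κ̂e. Within a cycle
all vectors of both processes have size O(e), and corresponding vectors differ by O(εe) = O(κ̂e²),
which is the claim. Sums preserve this, and Taylor's estimate carries it from iterates to residuals.
The coefficients are quotients of inner products of order e², hence bounded and perturbed by O(ε),
provided that the pivots |vᵀq| are at least c e². Since m_k ≤ m, finitely many constants suffice; κ̂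
enters only through ε and a smallness condition ε ≤ θ, so C does not depend on it.

The pivot bound is the heart. Just after a restart the linear process has p̂ = β r̂, and positive
definiteness bounds its pivot below (`SweepModel.le_inner_first`). Perturbation transfers this to
the nonlinear process, the τ-test extends it to all later nonlinear pivots, and perturbation brings
it back to the linear ones. `exists_cycleBounds` is this induction along a cycle.

Process II is described by orthogonality, not by sweeps. Since v_i ⊥ q_{i'} for i < i', nonzero
pivots make the sweep the only solution; if e = 0 all vectors vanish and the coefficients are
immaterial. Finally, the residual hypothesis keeps the iterates near x* (`ProcessI.norm_sub_le`). -/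

/-- `u` and `u'` are of size `K e`, and differ by at most `K ε e`. -/
structure Pert {E : Type*} [NormedAddCommGroup E] (K e ε : ℝ) (u u' : E) : Prop where
  left : ‖u‖ ≤ K * e
  right : ‖u'‖ ≤ K * e
  diff : ‖u - u'‖ ≤ K * ε * e

/-! ### Arithmetic of perturbations. -/

section Calculus

variable {E : Type*} [NormedAddCommGroup E]
  {K K' e ε : ℝ} {u u' w w' : E}

theorem Pert.mono (h : Pert K e ε u u') (hK : K ≤ K') (he : 0 ≤ e) (hε : 0 ≤ ε) :
    Pert K' e ε u u' :=
  ⟨h.left.trans (by gcongr), h.right.trans (by gcongr), h.diff.trans (by gcongr)⟩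

theorem Pert.add (h : Pert K e ε u u') (h' : Pert K' e ε w w') :
    Pert (K + K') e ε (u + w) (u' + w') := by
  refine ⟨?_, ?_, ?_⟩
  · linarith [norm_add_le u w, h.left, h'.left]
  · linarith [norm_add_le u' w', h.right, h'.right]
  · have := norm_add_le (u - u') (w - w')
    rw [add_sub_add_comm]
    linarith [h.diff, h'.diff]

theorem Pert.neg (h : Pert K e ε u u') : Pert K e ε (-u) (-u') := by
  refine ⟨by simpa using h.left, by simpa using h.right, ?_⟩
  rw [← neg_sub', norm_neg]
  exact h.diff

theorem Pert.sub (h : Pert K e ε u u') (h' : Pert K' e ε w w') :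
    Pert (K + K') e ε (u - w) (u' - w') := by
  simpa only [sub_eq_add_neg] using h.add h'.neg

variable [InnerProductSpace ℝ E]

theorem Pert.smul {G a a' : ℝ} (hG : 0 ≤ G) (hK : 0 ≤ K) (he : 0 ≤ e) (hε : 0 ≤ ε)
    (h : Pert K e ε u u') (ha : |a| ≤ G) (ha' : |a'| ≤ G)
    (hd : |a - a'| ≤ G * ε) : Pert (2 * G * K) e ε (a • u) (a' • u') := by
  have hGK : 0 ≤ G * K * e := by positivity
  refine ⟨?_, ?_, ?_⟩
  · rw [norm_smul, Real.norm_eq_abs]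
    have := mul_le_mul ha h.left (norm_nonneg _) hG
    linarith
  · rw [norm_smul, Real.norm_eq_abs]
    have := mul_le_mul ha' h.right (norm_nonneg _) hG
    linarith
  · have e1 : a • u - a' • u' = (a - a') • u + a' • (u - u') := by
      rw [sub_smul, smul_sub]; abel
    rw [e1]
    refine (norm_add_le _ _).trans ?_
    rw [norm_smul, norm_smul, Real.norm_eq_abs, Real.norm_eq_abs]
    have h1 := mul_le_mul hd h.left (norm_nonneg _) (by positivity)
    have h2 := mul_le_mul ha' h.diff (norm_nonneg _) hG
    linarith

theorem Pert.abs_inner (hK : 0 ≤ K) (he : 0 ≤ e)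
    (h : Pert K e ε u u') (h' : Pert K' e ε w w') : |inner ℝ u w| ≤ K * K' * e ^ 2 := by
  have := mul_le_mul h.left h'.left (norm_nonneg _) (by positivity)
  have := abs_real_inner_le_norm u w
  linarith

theorem Pert.abs_inner' (hK : 0 ≤ K) (he : 0 ≤ e)
    (h : Pert K e ε u u') (h' : Pert K' e ε w w') : |inner ℝ u' w'| ≤ K * K' * e ^ 2 := by
  have := mul_le_mul h.right h'.right (norm_nonneg _) (by positivity)
  have := abs_real_inner_le_norm u' w'
  linarith

theorem Pert.inner_sub (hK : 0 ≤ K) (he : 0 ≤ e) (hε : 0 ≤ ε)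
    (h : Pert K e ε u u') (h' : Pert K' e ε w w') :
    |inner ℝ u w - inner ℝ u' w'| ≤ 2 * K * K' * ε * e ^ 2 := by
  have e1 : (inner ℝ u w - inner ℝ u' w' : ℝ) = inner ℝ (u - u') w + inner ℝ u' (w - w') := by
    rw [inner_sub_left, inner_sub_right]; ring
  rw [e1]
  refine (abs_add_le _ _).trans ?_
  have h1 := mul_le_mul h.diff h'.left (norm_nonneg _) (by positivity)
  have h2 := mul_le_mul h.right h'.diff (norm_nonneg _) (by positivity)
  have := abs_real_inner_le_norm (u - u') w
  have := abs_real_inner_le_norm u' (w - w')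
  linarith

/-- Quotients of perturbed numbers of size `e ^ 2`; with `e = 0` all of them vanish. -/
theorem abs_div_sub_div_le {a a' b b' c A A' D : ℝ} (hc : 0 < c) (he : 0 ≤ e)
    (hε : 0 ≤ ε) (hA : 0 ≤ A) (hA' : 0 ≤ A') (hD : 0 ≤ D)
    (ha : |a| ≤ A * e ^ 2) (ha' : |a'| ≤ A * e ^ 2)
    (hd : |a - a'| ≤ A' * ε * e ^ 2) (hdb : |b - b'| ≤ D * ε * e ^ 2)
    (hb : c * e ^ 2 ≤ |b|) (hb' : c * e ^ 2 ≤ |b'|) :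
    |a / b| ≤ A / c ∧ |a' / b'| ≤ A / c ∧ |a / b - a' / b'| ≤ (A' / c + A * D / c ^ 2) * ε := by
  rcases he.eq_or_lt with rfl | he
  · have h0 : a = 0 := by simpa using ha
    have h0' : a' = 0 := by simpa using ha'
    subst h0 h0'
    simp only [zero_div, abs_zero, sub_self]
    exact ⟨by positivity, by positivity, by positivity⟩
  have hce : 0 < c * e ^ 2 := by positivity
  have hbp := hce.trans_le hb
  have hbp' := hce.trans_le hb'
  have hb0 : b ≠ 0 := abs_pos.1 hbp
  have hb0' : b' ≠ 0 := abs_pos.1 hbp'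
  have key : ∀ y z P : ℝ, 0 ≤ P → |y| ≤ P * e ^ 2 → c * e ^ 2 ≤ |z| → |y / z| ≤ P / c := by
    intro y z P hP hy hz
    rw [abs_div, div_le_div_iff₀ (hce.trans_le hz) hc]
    calc |y| * c ≤ P * e ^ 2 * c := by gcongr
      _ = P * (c * e ^ 2) := by ring
      _ ≤ P * |z| := by gcongr
  refine ⟨key _ _ _ hA ha hb, key _ _ _ hA ha' hb', ?_⟩
  have e1 : a / b - a' / b' = (a - a') / b - (a' / b') * ((b - b') / b) := by
    field_simp; ring
  have k1 := key (a - a') b (A' * ε) (by positivity) hd hb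
  have k2 := key (b - b') b (D * ε) (by positivity) hdb hb
  have k3 := key a' b' A hA ha' hb'
  rw [e1]
  calc _ ≤ |(a - a') / b| + |a' / b'| * |(b - b') / b| := by
        rw [← abs_mul]; exact abs_sub _ _
    _ ≤ A' * ε / c + (A / c) * (D * ε / c) := by gcongr
    _ = _ := by field_simp

end Calculus

/-! ### Sweeps: stability, and characterisation by orthogonality. -/

variable {d : ℕ}

/-- The growth factor of the perturbation constant in one step of a sweep. -/
def sweepFactor (K c : ℝ) : ℝ := 1 + 2 * (2 * K / c + 2 * K ^ 3 / c ^ 2) * K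

theorem one_le_sweepFactor {K c : ℝ} (hK : 0 ≤ K) (hc : 0 < c) : 1 ≤ sweepFactor K c := by
  unfold sweepFactor
  have : 0 ≤ 2 * (2 * K / c + 2 * K ^ 3 / c ^ 2) * K := by positivity
  linarith

/-- The resulting constant is linear in `K₁`, so each step of a sweep multiplies the constant of the
residual by a fixed factor. -/
theorem sweep_step_pert {K K₁ c e ε : ℝ} {v v' p p' q q' b b' : Vec d} (hK : 0 ≤ K)
    (hK₁ : 0 ≤ K₁) (hc : 0 < c) (he : 0 ≤ e) (hε : 0 ≤ ε)
    (hv : Pert K e ε v v') (hp : Pert K e ε p p') (hq : Pert K e ε q q') (hb : Pert K₁ e ε b b')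
    (hvq : c * e ^ 2 ≤ |inner ℝ v q|) (hvq' : c * e ^ 2 ≤ |inner ℝ v' q'|) :
    Pert (2 * (K₁ * (2 * K / c + 2 * K ^ 3 / c ^ 2)) * K) e ε
      ((inner ℝ v b / inner ℝ v q : ℝ) • p) ((inner ℝ v' b' / inner ℝ v' q' : ℝ) • p') := by
  obtain ⟨h1, h2, h3⟩ := abs_div_sub_div_le (A := K * K₁) (A' := 2 * K * K₁) (D := 2 * K * K)
    hc he hε (by positivity) (by positivity) (by positivity)
    (hv.abs_inner hK he hb) (hv.abs_inner' hK he hb) (hv.inner_sub hK he hε hb)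
    (hv.inner_sub hK he hε hq) hvq hvq'
  have hG : K * K₁ / c ≤ K₁ * (2 * K / c + 2 * K ^ 3 / c ^ 2) := by
    have e1 : K₁ * (2 * K / c + 2 * K ^ 3 / c ^ 2)
      = K * K₁ / c + (K * K₁ / c + 2 * K₁ * K ^ 3 / c ^ 2) := by ring
    have : 0 ≤ K * K₁ / c + 2 * K₁ * K ^ 3 / c ^ 2 := by positivity
    linarith
  refine hp.smul (by positivity) hK he hε (h1.trans hG) (h2.trans hG) (h3.trans (le_of_eq ?_))
  ring

/-- Perturbation bounds propagate through a sweep. -/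
theorem sweep_pert {K K₁ c e ε : ℝ} {v v' p p' q q' : ℕ → Vec d} {s : ℕ} {a a' b b' z : Vec d}
    (hK : 0 ≤ K) (hK₁ : 0 ≤ K₁) (hc : 0 < c) (he : 0 ≤ e) (hε : 0 ≤ ε)
    (ha : Pert K₁ e ε (a - z) (a' - z)) (hb : Pert K₁ e ε b b') (j : ℕ)
    (hv : ∀ i, 1 ≤ i → i ≤ j → Pert K e ε (v (s + i)) (v' (s + i)))
    (hp : ∀ i, 1 ≤ i → i ≤ j → Pert K e ε (p (s + i)) (p' (s + i)))
    (hq : ∀ i, 1 ≤ i → i ≤ j → Pert K e ε (q (s + i)) (q' (s + i)))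
    (hvq : ∀ i, 1 ≤ i → i ≤ j → c * e ^ 2 ≤ |inner ℝ (v (s + i)) (q (s + i))|)
    (hvq' : ∀ i, 1 ≤ i → i ≤ j → c * e ^ 2 ≤ |inner ℝ (v' (s + i)) (q' (s + i))|) :
    Pert (K₁ * sweepFactor K c ^ j) e ε ((sweep v p q s a b j).1 - z)
      ((sweep v' p' q' s a' b' j).1 - z) ∧
    Pert (K₁ * sweepFactor K c ^ j) e ε (sweep v p q s a b j).2 (sweep v' p' q' s a' b' j).2 := by
  -- The base point `z` will be the solution when iterates are swept, and 0 when differences are.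
  induction j with
  | zero => simpa [sweep] using ⟨ha, hb⟩
  | succ j ih =>
    obtain ⟨iha, ihb⟩ := ih (fun i h1 h2 => hv i h1 (by omega)) (fun i h1 h2 => hp i h1 (by omega))
      (fun i h1 h2 => hq i h1 (by omega)) (fun i h1 h2 => hvq i h1 (by omega))
      (fun i h1 h2 => hvq' i h1 (by omega))
    have hs := one_le_sweepFactor hK hc
    have hK₂ : 0 ≤ K₁ * sweepFactor K c ^ j := by positivity
    have h1 : 1 ≤ j + 1 := by omega
    have s1 := sweep_step_pert hK hK₂ hc he hε (hv _ h1 le_rfl) (hp _ h1 le_rfl) (hq _ h1 le_rfl)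
      ihb (hvq _ h1 le_rfl) (hvq' _ h1 le_rfl)
    have s2 := sweep_step_pert hK hK₂ hc he hε (hv _ h1 le_rfl) (hq _ h1 le_rfl) (hq _ h1 le_rfl)
      ihb (hvq _ h1 le_rfl) (hvq' _ h1 le_rfl)
    have e1 : K₁ * sweepFactor K c ^ (j + 1) = K₁ * sweepFactor K c ^ j +
        2 * (K₁ * sweepFactor K c ^ j * (2 * K / c + 2 * K ^ 3 / c ^ 2)) * K := by
      rw [pow_succ]
      conv_lhs => rw [show sweepFactor K c ^ j * sweepFactor K c = sweepFactor K c ^ j *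
        (1 + 2 * (2 * K / c + 2 * K ^ 3 / c ^ 2) * K) from rfl]
      ring
    rw [e1]
    refine ⟨?_, ihb.sub s2⟩
    have := iha.sub s1
    simpa only [sweep, sub_right_comm, add_assoc s j 1] using this

theorem sweep_congr {v v' p p' q q' : ℕ → Vec d} {s : ℕ} {a b : Vec d} (j : ℕ)
    (hv : ∀ i, 1 ≤ i → i ≤ j → v (s + i) = v' (s + i))
    (hp : ∀ i, 1 ≤ i → i ≤ j → p (s + i) = p' (s + i))
    (hq : ∀ i, 1 ≤ i → i ≤ j → q (s + i) = q' (s + i)) :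
    sweep v p q s a b j = sweep v' p' q' s a b j := by
  induction j with
  | zero => rfl
  | succ j ih =>
    have h1 : 1 ≤ j + 1 := by omega
    simp only [sweep, ih (fun i h1 h2 => hv i h1 (by omega)) (fun i h1 h2 => hp i h1 (by omega))
      (fun i h1 h2 => hq i h1 (by omega)), add_assoc, hv _ h1 le_rfl, hp _ h1 le_rfl,
      hq _ h1 le_rfl]

/-- A sweep subtracts linear combinations with common coefficients. -/
theorem exists_sweep_eq_sub_sum (v p q : ℕ → Vec d) (s : ℕ) (a b : Vec d) :
    ∃ ζ : ℕ → ℝ, ∀ j, sweep v p q s a b j =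
      (a - ∑ i ∈ Finset.Icc 1 j, ζ i • p (s + i), b - ∑ i ∈ Finset.Icc 1 j, ζ i • q (s + i)) := by
  refine ⟨fun i => inner ℝ (v (s + i)) (sweep v p q s a b (i - 1)).2 /
    inner ℝ (v (s + i)) (q (s + i)), fun j => ?_⟩
  induction j with
  | zero => simp [sweep]
  | succ j ih =>
    rw [Finset.sum_Icc_succ_top (by omega), Finset.sum_Icc_succ_top (by omega), ← sub_sub,
      ← sub_sub]
    simp only [sweep, Nat.add_sub_cancel, ← add_assoc]
    rw [ih]

/-- The triple `(v, p, q)` can be used in a projection: either it vanishes, or `⟪v, q⟫ ≠ 0`. -/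
def NonDegenerate (v p q : Vec d) : Prop := (v = 0 ∧ p = 0 ∧ q = 0) ∨ inner ℝ v q ≠ (0 : ℝ)

/-- A sweep makes the residual orthogonal to the directions that it uses. -/
theorem inner_sweep_eq_zero {v p q : ℕ → Vec d} {s : ℕ} {a b : Vec d} (j : ℕ)
    (tri : ∀ i i', 1 ≤ i → i < i' → i' ≤ j → inner ℝ (v (s + i)) (q (s + i')) = (0 : ℝ))
    (nd : ∀ i, 1 ≤ i → i ≤ j → NonDegenerate (v (s + i)) (p (s + i)) (q (s + i)))
    (i : ℕ) (hi : 1 ≤ i) (hij : i ≤ j) :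
    inner ℝ (v (s + i)) (sweep v p q s a b j).2 = (0 : ℝ) := by
  induction j with
  | zero => omega
  | succ j ih =>
    simp only [sweep, inner_sub_right, inner_smul_right, add_assoc]
    rcases Nat.lt_or_ge j i with h | h
    · obtain rfl : i = j + 1 := by omega
      rcases nd _ hi le_rfl with ⟨h0, -, -⟩ | h0
      · simp [h0]
      · rw [div_mul_cancel₀ _ h0, sub_self]
    · rw [ih (fun i i' h1 h2 h3 => tri i i' h1 h2 (by omega)) (fun i h1 h2 => nd i h1 (by omega)) h,
        tri i (j + 1) hi (by omega) le_rfl]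
      simp

/-- Coefficients that make the residual orthogonal to the directions are those of a sweep. -/
theorem sweep_eq_of_inner_eq_zero {v p q : ℕ → Vec d} {s : ℕ} {a b : Vec d} {ζ : ℕ → ℝ} (J : ℕ)
    (tri : ∀ i i', 1 ≤ i → i < i' → i' ≤ J → inner ℝ (v (s + i)) (q (s + i')) = (0 : ℝ))
    (nd : ∀ i, 1 ≤ i → i ≤ J → NonDegenerate (v (s + i)) (p (s + i)) (q (s + i)))
    (orth : ∀ i ∈ Finset.Icc 1 J,
      inner ℝ (v (s + i)) (b - ∑ i ∈ Finset.Icc 1 J, ζ i • q (s + i)) = (0 : ℝ)) :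
    sweep v p q s a b J =
      (a - ∑ i ∈ Finset.Icc 1 J, ζ i • p (s + i), b - ∑ i ∈ Finset.Icc 1 J, ζ i • q (s + i)) := by
  -- By triangularity the terms after the `i`-th are invisible to `v_i`, so orthogonality of the
  -- full residual to `v_i` is a condition on the partial residual.
  have stab : ∀ i, 1 ≤ i → ∀ j, i ≤ j → j ≤ J →
      inner ℝ (v (s + i)) (b - ∑ i ∈ Finset.Icc 1 j, ζ i • q (s + i)) =
      (inner ℝ (v (s + i)) (b - ∑ i ∈ Finset.Icc 1 i, ζ i • q (s + i)) : ℝ) := by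
    intro i hi j hij
    induction j, hij using Nat.le_induction with
    | base => intro _; rfl
    | succ j hij ih =>
      intro hj
      rw [Finset.sum_Icc_succ_top (by omega), ← sub_sub, inner_sub_right, ih (by omega),
        inner_smul_right, tri i (j + 1) hi (by omega) hj, mul_zero, sub_zero]
  have main : ∀ j, j ≤ J → sweep v p q s a b j =
      (a - ∑ i ∈ Finset.Icc 1 j, ζ i • p (s + i), b - ∑ i ∈ Finset.Icc 1 j, ζ i • q (s + i)) := by
    intro j
    induction j with
    | zero => intro _; simp [sweep]
    | succ j ih =>
      intro hj
      have h1 : 1 ≤ j + 1 := by omega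
      have h0 := orth (j + 1) (Finset.mem_Icc.2 ⟨h1, hj⟩)
      rw [stab (j + 1) h1 J hj le_rfl, Finset.sum_Icc_succ_top (by omega), ← sub_sub,
        inner_sub_right, inner_smul_right, sub_eq_zero] at h0
      rw [Finset.sum_Icc_succ_top (by omega), Finset.sum_Icc_succ_top (by omega), ← sub_sub,
        ← sub_sub]
      simp only [sweep, ih (by omega), add_assoc]
      -- A zero triple makes `ζ` irrelevant; a nonzero pivot forces it to be the quotient used by
      -- the sweep.
      rcases nd (j + 1) h1 hj with ⟨-, hp, hq⟩ | hn
      · simp [hp, hq]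
      · rw [h0, mul_div_cancel_right₀ _ hn]
  exact main J le_rfl

end RestartedAM
end

/-! ### Local estimates for `h`, and the index structure of cycles. -/

noncomputable section
namespace RestartedAM

variable {d : ℕ} {ty : AMType} {g : Vec d → Vec d} {mem : ℕ} {τ η : ℝ} {β : ℕ → ℝ}
  {xs : Vec d} {ρ κ μ L : ℝ}

theorem AMType.dir_congr {p q p' q' : ℕ → Vec d} {i : ℕ} (ty : AMType) (hp : p i = p' i)
    (hq : q i = q' i) : ty.dir p q i = ty.dir p' q' i := by
  cases ty
  · exact hp
  · exact hq

theorem AMType.dir_pert {p q p' q' : ℕ → Vec d} {i : ℕ} {K e ε : ℝ} (ty : AMType)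
    (hp : Pert K e ε (p i) (p' i)) (hq : Pert K e ε (q i) (q' i)) :
    Pert K e ε (ty.dir p q i) (ty.dir p' q' i) := by
  cases ty
  · exact hp
  · exact hq

theorem resid_eq_neg (g : Vec d → Vec d) (x : Vec d) : resid g x = -hfun g x := by
  simp [resid, hfun]

section Local

theorem LocalConstants.hfun_le (h : LocalConstants g xs ρ κ μ L) {x : Vec d}
    (hx : ‖x - xs‖ ≤ ρ) : ‖hfun g x‖ ≤ L * ‖x - xs‖ + 1 / 2 * κ * ‖x - xs‖ ^ 2 := by
  have h1 := h.taylor x (mem_closedBall_iff_norm.2 hx)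
  have h2 := h.jac_upper xs (Metric.mem_closedBall_self h.rho_pos.le) (x - xs)
  have h3 := norm_sub_norm_le (hfun g x) (fderiv ℝ (hfun g) xs (x - xs))
  linarith

/-- The Taylor remainder uses up at most half of the lower bound for the linear part. -/
theorem LocalConstants.le_hfun (h : LocalConstants g xs ρ κ μ L) {x : Vec d}
    (hx : ‖x - xs‖ ≤ ρ) (hx' : κ * ‖x - xs‖ ≤ μ) : μ / 2 * ‖x - xs‖ ≤ ‖hfun g x‖ := by
  have h1 := h.taylor x (mem_closedBall_iff_norm.2 hx)
  have h2 := h.jac_lower xs (Metric.mem_closedBall_self h.rho_pos.le) (x - xs)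
  have h3 := norm_sub_norm_le (fderiv ℝ (hfun g) xs (x - xs)) (hfun g x)
  rw [norm_sub_rev] at h3
  have h4 := mul_le_mul_of_nonneg_right hx' (norm_nonneg (x - xs))
  linarith

/-- The difference consists of a Taylor remainder of order κe² and the Jacobian applied to `x - x'`.
This is where the relative error ε = κe originates. -/
theorem LocalConstants.resid_pert (h : LocalConstants g xs ρ κ μ L) {K e : ℝ}
    (he : 0 ≤ e) (hKe : K * e ≤ ρ) (hκ : κ * e ≤ 1) {x x' : Vec d}
    (hx : Pert K e (κ * e) (x - xs) (x' - xs)) :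
    Pert (K ^ 2 + L * K) e (κ * e) (resid g x) (linResid g xs x') := by
  have hk := h.kappa_pos
  have hL := h.L_pos
  have hxs : xs ∈ Metric.closedBall xs ρ := Metric.mem_closedBall_self h.rho_pos.le
  have hsq : ‖x - xs‖ ^ 2 ≤ (K * e) ^ 2 := by gcongr; exact hx.left
  have hsq' : 1 / 2 * κ * ‖x - xs‖ ^ 2 ≤ 1 / 2 * κ * (K * e) ^ 2 := by gcongr
  have hLe : L * ‖x - xs‖ ≤ L * (K * e) := by gcongr; exact hx.left
  have hke : κ * (K * e) ^ 2 ≤ K ^ 2 * e := by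
    have := mul_le_mul_of_nonneg_right hκ (by positivity : 0 ≤ K ^ 2 * e)
    linarith
  have hn : 0 ≤ K ^ 2 * e := by positivity
  have hn2 : 0 ≤ κ * (K * e) ^ 2 := by positivity
  refine ⟨?_, ?_, ?_⟩
  · rw [resid_eq_neg, norm_neg]
    have := h.hfun_le (hx.left.trans hKe)
    linarith
  · rw [linResid, norm_neg]
    have h1 := h.jac_upper xs hxs (x' - xs)
    have h2 : L * ‖x' - xs‖ ≤ L * (K * e) := by gcongr; exact hx.right
    linarith
  · have e1 : resid g x - linResid g xs x' =
        -(hfun g x - fderiv ℝ (hfun g) xs (x - xs)) -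
          fderiv ℝ (hfun g) xs ((x - xs) - (x' - xs)) := by
      rw [map_sub _ (x - xs) (x' - xs), resid_eq_neg, linResid]; abel
    rw [e1]
    refine (norm_sub_le _ _).trans ?_
    rw [norm_neg]
    have h1 := h.taylor x (mem_closedBall_iff_norm.2 (hx.left.trans hKe))
    have h2 := h.jac_upper xs hxs ((x - xs) - (x' - xs))
    have h3 : L * ‖(x - xs) - (x' - xs)‖ ≤ L * (K * (κ * e) * e) := by gcongr; exact hx.diff
    linarith

end Local

namespace ProcessI

variable (R : ProcessI ty g mem τ η β)

theorem m_eq_n {k : ℕ} (hk : 0 < R.m k) : R.m k = R.n k ∧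
    τ * |inner ℝ (ty.dir R.p R.q (k - R.n k + 1)) (R.q (k - R.n k + 1))| ≤
      |inner ℝ (ty.dir R.p R.q k) (R.q k)| := by
  have h := R.m_eq k
  split_ifs at h with hc
  · omega
  · refine ⟨h, ?_⟩
    by_contra hlt
    exact hc ⟨h ▸ hk, not_le.1 hlt⟩

theorem n_eq_enterLen {k : ℕ} (hk : 0 < R.n k) : R.n k = enterLen R.m k ∧ R.n k ≤ mem := by
  have h := R.n_eq k
  split_ifs at h with hc
  · omega
  · exact ⟨h, by push Not at hc; omega⟩

theorem m_zero : R.m 0 = 0 := by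
  by_contra h
  have h1 := (R.m_eq_n (Nat.pos_of_ne_zero h)).1
  have h2 := (R.n_eq_enterLen (k := 0) (by omega)).1
  simp only [enterLen] at h2
  omega

theorem m_le_mem (k : ℕ) : R.m k ≤ mem := by
  rcases Nat.eq_zero_or_pos (R.m k) with h | h
  · omega
  · have h1 := (R.m_eq_n h).1
    have := (R.n_eq_enterLen (k := k) (by omega)).2
    omega

theorem m_succ {k : ℕ} (hk : 0 < R.m (k + 1)) : R.m (k + 1) = R.m k + 1 := by
  have h1 := (R.m_eq_n hk).1
  have := (R.n_eq_enterLen (k := k + 1) (by omega)).1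
  simp only [enterLen] at this
  omega

theorem m_le (k : ℕ) : R.m k ≤ k := by
  induction k with
  | zero => rw [R.m_zero]
  | succ k ih =>
    rcases Nat.eq_zero_or_pos (R.m (k + 1)) with h | h
    · omega
    · rw [R.m_succ h]; omega

/-- Going back inside a cycle lowers `m` by one per iteration, so all its iterations share one
restart index. -/
theorem m_sub (k i : ℕ) (hi : i ≤ R.m k) : R.m (k - i) = R.m k - i := by
  induction i with
  | zero => rfl
  | succ i ih =>
    have h1 := ih (by omega)
    have h2 := R.m_le k
    obtain ⟨l, hl⟩ : ∃ l, k - i = l + 1 := ⟨k - i - 1, by omega⟩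
    have h3 := R.m_succ (k := l) (by rw [← hl]; omega)
    rw [← hl, h1] at h3
    rw [show k - (i + 1) = l by omega]
    omega

theorem pair_eq_sweep {k : ℕ} (hk : 0 < R.m k) : (R.p k, R.q k) =
    sweep (ty.dir R.p R.q) R.p R.q (k - R.m k) (R.x k - R.x (k - 1))
      (resid g (R.x k) - resid g (R.x (k - 1))) (R.m k - 1) := by
  have h := (R.m_eq_n hk).1
  rw [h]
  exact R.pair_eq k (h ▸ hk)

/-- A cycle that goes on has passed the τ-test, which compares the new pivot with the first pivot of
the cycle. -/
theorem le_inner {k : ℕ} (hk : 0 < R.m k) :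
    τ * |inner ℝ (ty.dir R.p R.q (k - R.m k + 1)) (R.q (k - R.m k + 1))| ≤
      |inner ℝ (ty.dir R.p R.q k) (R.q k)| := by
  obtain ⟨h, h'⟩ := R.m_eq_n hk
  rw [h]
  exact h'

end ProcessI

/-! ### The linear process in sweep form, and its comparison with Process I in one iteration. -/

/-- The point that iteration `k` of the linear process produces, with the projection carried out
by a sweep. -/
def sweepNext (R : ProcessI ty g mem τ η β) (xs : Vec d) (xh ph qh : ℕ → Vec d) (k : ℕ) : Vec d :=
  (sweep (ty.dir ph qh) ph qh (k - R.m k) (xh k) (linResid g xs (xh k)) (R.m k)).1 +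
    β k • (sweep (ty.dir ph qh) ph qh (k - R.m k) (xh k) (linResid g xs (xh k)) (R.m k)).2

/-- The linear process with projections carried out by sweeps: `xh`, `ph`, `qh` in the iterations
up to `N`, and `out` up to index `N`. -/
structure SweepModel (R : ProcessI ty g mem τ η β) (xs : Vec d) (N : ℕ)
    (xh out ph qh : ℕ → Vec d) : Prop where
  restart : ∀ k ≤ N, R.m k = 0 → xh k = R.x k
  cont : ∀ k ≤ N, 0 < R.m k → xh k = out k
  pair : ∀ k ≤ N, 0 < R.m k → (ph k, qh k) = sweep (ty.dir ph qh) ph qh (k - R.m k)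
    (xh k - xh (k - 1)) (linResid g xs (xh k) - linResid g xs (xh (k - 1))) (R.m k - 1)
  step : ∀ k < N, out (k + 1) = sweepNext R xs xh ph qh k

theorem SweepModel.mono {R : ProcessI ty g mem τ η β} {N N' : ℕ} {xh out ph qh : ℕ → Vec d}
    (h : SweepModel R xs N xh out ph qh) (hN : N' ≤ N) : SweepModel R xs N' xh out ph qh :=
  ⟨fun k hk => h.restart k (hk.trans hN), fun k hk => h.cont k (hk.trans hN),
    fun k hk => h.pair k (hk.trans hN), fun k hk => h.step k (hk.trans_le hN)⟩

/-- The comparison of the two processes in iteration `k`. -/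
structure CycleBounds (R : ProcessI ty g mem τ η β) (xs : Vec d) (K c e ε : ℝ) (k : ℕ)
    (xh ph qh : ℕ → Vec d) : Prop where
  x : Pert K e ε (R.x k - xs) (xh k - xs)
  r : Pert K e ε (resid g (R.x k)) (linResid g xs (xh k))
  p : ∀ i, 1 ≤ i → i ≤ R.m k → Pert K e ε (R.p (k - R.m k + i)) (ph (k - R.m k + i))
  q : ∀ i, 1 ≤ i → i ≤ R.m k → Pert K e ε (R.q (k - R.m k + i)) (qh (k - R.m k + i))
  low : ∀ i, 1 ≤ i → i ≤ R.m k →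
    c * e ^ 2 ≤ |inner ℝ (ty.dir R.p R.q (k - R.m k + i)) (R.q (k - R.m k + i))|
  low' : ∀ i, 1 ≤ i → i ≤ R.m k →
    c * e ^ 2 ≤ |inner ℝ (ty.dir ph qh (k - R.m k + i)) (qh (k - R.m k + i))|

namespace CycleBounds

variable {R : ProcessI ty g mem τ η β} {K K' c e ε : ℝ} {k : ℕ} {xh ph qh : ℕ → Vec d}

theorem mono (h : CycleBounds R xs K c e ε k xh ph qh) (hK : K ≤ K') (he : 0 ≤ e) (hε : 0 ≤ ε) :
    CycleBounds R xs K' c e ε k xh ph qh :=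
  ⟨h.x.mono hK he hε, h.r.mono hK he hε, fun i h1 h2 => (h.p i h1 h2).mono hK he hε,
    fun i h1 h2 => (h.q i h1 h2).mono hK he hε, h.low, h.low'⟩

theorem dir (h : CycleBounds R xs K c e ε k xh ph qh) (i : ℕ) (h1 : 1 ≤ i) (h2 : i ≤ R.m k) :
    Pert K e ε (ty.dir R.p R.q (k - R.m k + i)) (ty.dir ph qh (k - R.m k + i)) :=
  ty.dir_pert (h.p i h1 h2) (h.q i h1 h2)

/-- For `e = 0`, a restart exactly at the solution, the size bounds annihilate all vectors;
otherwise the pivots are nonzero. -/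
theorem nonDegenerate (h : CycleBounds R xs K c e ε k xh ph qh) (hc : 0 < c) (he : 0 ≤ e)
    (i : ℕ) (h1 : 1 ≤ i) (h2 : i ≤ R.m k) :
    NonDegenerate (ty.dir ph qh (k - R.m k + i)) (ph (k - R.m k + i)) (qh (k - R.m k + i)) := by
  rcases he.eq_or_lt with rfl | he
  · left
    have hd := (h.dir i h1 h2).right
    have hp := (h.p i h1 h2).right
    have hq := (h.q i h1 h2).right
    rw [mul_zero, norm_le_zero_iff] at hd hp hq
    exact ⟨hd, hp, hq⟩
  · right
    exact abs_pos.1 (lt_of_lt_of_le (by positivity) (h.low' i h1 h2))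

/-- The comparison of the points that iteration `k` produces. -/
theorem next (h : CycleBounds R xs K c e ε k xh ph qh) {B : ℝ} (hK : 0 ≤ K) (hc : 0 < c)
    (he : 0 ≤ e) (hε : 0 ≤ ε) (hB : 0 ≤ B) (hβ : |β k| ≤ B) :
    Pert (K * sweepFactor K c ^ R.m k + 2 * B * (K * sweepFactor K c ^ R.m k)) e ε
      (R.x (k + 1) - xs) (sweepNext R xs xh ph qh k - xs) := by
  have hs := one_le_sweepFactor hK hc
  obtain ⟨h1, h2⟩ := sweep_pert hK hK hc he hε h.x h.r (R.m k) h.dir h.p h.q h.low h.low'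
  have h3 := h1.add (h2.smul (a := β k) (a' := β k) hB (by positivity) he hε hβ hβ (by
    rw [sub_self, abs_zero]; positivity))
  rw [R.x_succ, sweepNext, add_sub_right_comm, add_sub_right_comm]
  exact h3

end CycleBounds

end RestartedAM
end

/-! ### Pivot bounds and the induction along a cycle. -/

noncomputable section
namespace RestartedAM

variable {d : ℕ} {ty : AMType} {g : Vec d → Vec d} {mem : ℕ} {τ η : ℝ} {β : ℕ → ℝ}
  {xs : Vec d} {ρ κ μ L : ℝ}

/-- Type-I uses the quadratic form of the Jacobian, Type-II the norm of its image; the minimum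
serves both. -/
theorem LocalConstants.le_inner_dir (h : LocalConstants g xs ρ κ μ L) (ty : AMType)
    {p q : ℕ → Vec d} {i : ℕ} {t : ℝ} (ht : 0 ≤ t) (hp : t ≤ ‖p i‖)
    (hq : q i = -(fderiv ℝ (hfun g) xs (p i))) :
    min μ (μ ^ 2) * t ^ 2 ≤ |inner ℝ (ty.dir p q i) (q i)| := by
  have hμ := h.mu_pos
  have hxs : xs ∈ Metric.closedBall xs ρ := Metric.mem_closedBall_self h.rho_pos.le
  cases ty
  · change _ ≤ |inner ℝ (p i) (q i)|
    rw [hq, inner_neg_right, abs_neg]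
    calc _ ≤ μ * ‖p i‖ ^ 2 := by gcongr; exact min_le_left _ _
      _ ≤ _ := (h.quad_lower xs hxs (p i)).trans (le_abs_self _)
  · change _ ≤ |inner ℝ (q i) (q i)|
    rw [real_inner_self_eq_norm_sq, hq, norm_neg]
    calc _ ≤ μ ^ 2 * ‖p i‖ ^ 2 := by gcongr; exact min_le_right _ _
      _ = (μ * ‖p i‖) ^ 2 := by ring
      _ ≤ ‖fderiv ℝ (hfun g) xs (p i)‖ ^ 2 := by gcongr; exact h.jac_lower xs hxs (p i)
      _ ≤ _ := le_abs_self _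

/-- The lower bound for `|⟪v, q⟫| / ‖x - xs‖ ^ 2` in the first iteration after a restart. -/
def startConst (μ βlo : ℝ) : ℝ := min μ (μ ^ 2) * (βlo * μ) ^ 2

theorem startConst_pos {μ βlo : ℝ} (hμ : 0 < μ) (hβ : 0 < βlo) : 0 < startConst μ βlo := by
  unfold startConst; positivity

/-- Nothing is orthogonalised yet, so `ph (k + 1)` is `β k` times the residual, of norm at least
`βlo * μ * e`, and linearity gives `qh (k + 1)` exactly as minus the Jacobian applied to it. -/
theorem SweepModel.le_inner_first {R : ProcessI ty g mem τ η β} {N k : ℕ} {βlo : ℝ}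
    {xh out ph qh : ℕ → Vec d} (M : SweepModel R xs N xh out ph qh)
    (h : LocalConstants g xs ρ κ μ L) (hk : k + 1 ≤ N) (h0 : R.m k = 0) (h1 : R.m (k + 1) = 1)
    (hβlo : 0 < βlo) (hβ : βlo ≤ |β k|) :
    startConst μ βlo * ‖R.x k - xs‖ ^ 2 ≤
      |inner ℝ (ty.dir ph qh (k + 1)) (qh (k + 1))| := by
  have hμ := h.mu_pos
  have hxs : xs ∈ Metric.closedBall xs ρ := Metric.mem_closedBall_self h.rho_pos.le
  have hx : xh k = R.x k := M.restart k (by omega) h0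
  have hx1 : xh (k + 1) = xh k + β k • linResid g xs (xh k) := by
    rw [M.cont (k + 1) hk (by omega), M.step k (by omega), sweepNext, h0]
    rfl
  have hpq := M.pair (k + 1) hk (by omega)
  rw [h1] at hpq
  simp only [Nat.add_sub_cancel, Nat.sub_self, sweep, Prod.mk.injEq] at hpq
  have hp : ph (k + 1) = β k • linResid g xs (xh k) := by rw [hpq.1, hx1]; abel
  have hq : qh (k + 1) = -(fderiv ℝ (hfun g) xs (ph (k + 1))) := by
    rw [hpq.2, hpq.1, linResid, linResid, ← sub_sub_sub_cancel_right (xh (k + 1)) (xh k) xs,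
      map_sub _ (xh (k + 1) - xs) (xh k - xs)]
    abel
  have := h.le_inner_dir ty (p := ph) (q := qh) (i := k + 1) (t := βlo * μ * ‖R.x k - xs‖)
    (by positivity) (by
      rw [hp, norm_smul, Real.norm_eq_abs, linResid, norm_neg, hx, mul_assoc]
      gcongr
      exact h.jac_lower xs hxs _) hq
  unfold startConst
  rwa [mul_assoc, ← mul_pow]

set_option maxHeartbeats 1000000 in
/-- Between two restarts, and close enough to the solution, the two processes stay close. -/
theorem exists_cycleBounds (d : ℕ) (ty : AMType) (mem : ℕ) {τ η βlo βhi μ L : ℝ}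
    (hτ0 : 0 < τ) (hτ1 : τ < 1) (hβlo : 0 < βlo) (hβhi : 0 < βhi) (hμ : 0 < μ) (hL : 0 < L)
    (i : ℕ) : ∃ K θ : ℝ, 1 ≤ K ∧ 0 < θ ∧ θ ≤ 1 ∧ ∀ (g : Vec d → Vec d) (xs : Vec d) (ρ κ : ℝ),
      LocalConstants g xs ρ κ μ L → ∀ β : ℕ → ℝ, (∀ k, βlo ≤ |β k| ∧ |β k| ≤ βhi) →
      ∀ (R : ProcessI ty g mem τ η β) (k : ℕ) (xh out ph qh : ℕ → Vec d),
      SweepModel R xs k xh out ph qh → R.m k = i → ‖R.x (k - R.m k) - xs‖ ≤ θ * ρ →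
      κ * ‖R.x (k - R.m k) - xs‖ ≤ θ →
      CycleBounds R xs K (τ * startConst μ βlo / 4) ‖R.x (k - R.m k) - xs‖
        (κ * ‖R.x (k - R.m k) - xs‖) k xh ph qh ∧
      (0 < R.m k → startConst μ βlo / 2 * ‖R.x (k - R.m k) - xs‖ ^ 2 ≤
        |inner ℝ (ty.dir R.p R.q (k - R.m k + 1)) (R.q (k - R.m k + 1))|) := by
  have hc0 := startConst_pos hμ hβlo
  set c₀ := startConst μ βlo with hc0def
  -- One factor 1/2 is lost in passing from the first linear pivot to the nonlinear one, τ in the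
  -- restart test, and another 1/2 in returning to the linear pivots.
  have hc : 0 < τ * c₀ / 4 := by positivity
  induction i with
  | zero =>
    refine ⟨1 + L, 1, by linarith, one_pos, le_rfl, ?_⟩
    intro g xs ρ κ h β hβ R k xh out ph qh M hm he hκ
    have hk := h.kappa_pos
    rw [hm, Nat.sub_zero] at he hκ ⊢
    have hx : Pert 1 ‖R.x k - xs‖ (κ * ‖R.x k - xs‖) (R.x k - xs) (xh k - xs) := by
      rw [M.restart k le_rfl hm]
      exact ⟨by simp, by simp, by rw [sub_self, norm_zero]; positivity⟩
    have hr := h.resid_pert (norm_nonneg _) (by simpa using he) hκ hx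
    have hr' := hr.mono (K' := 1 + L) (by linarith) (norm_nonneg _) (by positivity)
    refine ⟨⟨hx.mono (by linarith) (norm_nonneg _) (by positivity), hr', ?_, ?_, ?_, ?_⟩, ?_⟩ <;>
      omega
  | succ i ih =>
    obtain ⟨K, θ, hK1, hθ0, hθ1, ih⟩ := ih
    have hs := one_le_sweepFactor (by linarith : 0 ≤ K) hc
    set F := sweepFactor K (τ * c₀ / 4)
    have hF : 1 ≤ F ^ i := one_le_pow₀ hs
    -- `K₁` serves for the new iterate, `K₂` for its residual, `K₃` for the new pair; `K'` dominates
    -- them all.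
    set K₁ := K * F ^ i + 2 * βhi * (K * F ^ i) with hK₁
    have hK₁p : 0 < K₁ := by positivity
    set K₂ := K₁ ^ 2 + L * K₁ with hK₂
    have hK₂p : 0 < K₂ := by positivity
    set K₃ := (K₁ + K + K₂ + K) * F ^ i with hK₃
    have hK₃p : 0 < K₃ := by positivity
    set K' := K + K₁ + K₂ + K₃ with hK'
    have hK'p : 0 < K' := by positivity
    -- The bound `1 / K₁` keeps the new iterate in the ball; the last one limits the change of the
    -- new pivot to `τ * c₀ / 4 * e ^ 2`.
    refine ⟨K', min θ (min (1 / K₁) (τ * c₀ / (8 * K' ^ 2))), by linarith, by positivity,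
      (min_le_left _ _).trans hθ1, ?_⟩
    intro g xs ρ κ h β hβ R k xh out ph qh M hm he hκ
    have hkp := h.kappa_pos
    have hρ := h.rho_pos
    obtain ⟨l, rfl⟩ : ∃ l, k = l + 1 := ⟨k - 1, by have := R.m_le k; omega⟩
    have hml : R.m (l + 1) = R.m l + 1 := R.m_succ (by omega)
    have hli : R.m l = i := by omega
    have hsl : l + 1 - R.m (l + 1) = l - R.m l := by omega
    rw [hsl] at he hκ ⊢
    set e := ‖R.x (l - R.m l) - xs‖ with hedef
    have he0 : 0 ≤ e := norm_nonneg _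
    have hε0 : 0 ≤ κ * e := by positivity
    have hκ1 : κ * e ≤ θ := hκ.trans (min_le_left _ _)
    have hκ3 : κ * e ≤ τ * c₀ / (8 * K' ^ 2) :=
      hκ.trans ((min_le_right _ _).trans (min_le_right _ _))
    have he1 : e ≤ θ * ρ := he.trans (by gcongr; exact min_le_left _ _)
    have he2 : K₁ * e ≤ ρ := by
      have : e ≤ 1 / K₁ * ρ :=
        he.trans (by gcongr; exact (min_le_right _ _).trans (min_le_left _ _))
      calc K₁ * e ≤ K₁ * (1 / K₁ * ρ) := by gcongr
        _ = ρ := by field_simp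
    obtain ⟨cb, first⟩ := ih g xs ρ κ h β hβ R l xh out ph qh (M.mono (by omega)) hli he1 hκ1
    have hx := cb.next (by linarith) hc he0 hε0 hβhi.le (hβ l).2
    rw [hli, ← hK₁] at hx
    rw [← hli, ← M.step l (by omega), ← M.cont (l + 1) le_rfl (by omega)] at hx
    have hr := h.resid_pert he0 he2 (hκ1.trans hθ1) hx
    rw [← hK₂] at hr
    have hdx := hx.sub cb.x
    simp only [sub_sub_sub_cancel_right] at hdx
    have hdr := hr.sub cb.r
    have hpq := sweep_pert (K := K) (K₁ := K₁ + K + K₂ + K) (z := 0) (by linarith) (by positivity)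
      hc he0 hε0 (by simpa using hdx.mono (by linarith) he0 hε0) (hdr.mono (by linarith) he0 hε0)
      (R.m l) cb.dir cb.p cb.q cb.low cb.low'
    have hR := R.pair_eq_sweep (k := l + 1) (by omega)
    have hH := M.pair (l + 1) le_rfl (by omega)
    rw [hsl, hml, Nat.add_sub_cancel, Nat.add_sub_cancel] at hR hH
    rw [← hR, ← hH, hli, ← hK₃, sub_zero, sub_zero] at hpq
    obtain ⟨hp, hq⟩ := hpq
    have hp' := hp.mono (K' := K') (by linarith) he0 hε0
    have hq' := hq.mono (K' := K') (by linarith) he0 hε0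
    have hd : |inner ℝ (ty.dir R.p R.q (l + 1)) (R.q (l + 1)) -
        inner ℝ (ty.dir ph qh (l + 1)) (qh (l + 1))| ≤ τ * c₀ / 4 * e ^ 2 := by
      refine ((ty.dir_pert hp' hq').inner_sub hK'p.le he0 hε0 hq').trans ?_
      calc 2 * K' * K' * (κ * e) * e ^ 2
          ≤ 2 * K' * K' * (τ * c₀ / (8 * K' ^ 2)) * e ^ 2 := by gcongr
        _ = τ * c₀ / 4 * e ^ 2 := by field_simp; ring
    have hτc : τ * c₀ * e ^ 2 ≤ c₀ * e ^ 2 := by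
      have : 0 ≤ c₀ * e ^ 2 := by positivity
      have := mul_le_of_le_one_left this hτ1.le
      rwa [← mul_assoc] at this
    -- If iteration `l` is a restart, the new pivot is the first of the cycle and its bound comes
    -- from the linear process; otherwise the first pivot is an old one.
    have first' : c₀ / 2 * e ^ 2 ≤
        |inner ℝ (ty.dir R.p R.q (l - R.m l + 1)) (R.q (l - R.m l + 1))| := by
      rcases Nat.eq_zero_or_pos (R.m l) with h0 | h0
      · have := M.le_inner_first h le_rfl h0 (by omega) hβlo (hβ l).1
        rw [hedef] at hd hτc ⊢
        rw [h0, Nat.sub_zero] at hd hτc ⊢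
        have h3 := abs_sub_abs_le_abs_sub (inner ℝ (ty.dir ph qh (l + 1)) (qh (l + 1)) : ℝ)
          (inner ℝ (ty.dir R.p R.q (l + 1)) (R.q (l + 1)))
        rw [abs_sub_comm] at h3
        have h4 : 0 ≤ c₀ * ‖R.x l - xs‖ ^ 2 := by positivity
        linarith
      · exact first h0
    have hlow : τ * c₀ / 2 * e ^ 2 ≤ |inner ℝ (ty.dir R.p R.q (l + 1)) (R.q (l + 1))| := by
      have h1 := R.le_inner (k := l + 1) (by omega)
      rw [hsl] at h1
      have h2 := mul_le_mul_of_nonneg_left first' hτ0.le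
      linarith
    have hlow' : τ * c₀ / 4 * e ^ 2 ≤ |inner ℝ (ty.dir ph qh (l + 1)) (qh (l + 1))| := by
      have h3 := abs_sub_abs_le_abs_sub (inner ℝ (ty.dir R.p R.q (l + 1)) (R.q (l + 1)) : ℝ)
        (inner ℝ (ty.dir ph qh (l + 1)) (qh (l + 1)))
      linarith
    have split : ∀ j, 1 ≤ j → j ≤ R.m (l + 1) →
        (1 ≤ j ∧ j ≤ R.m l) ∨ l - R.m l + j = l + 1 := by
      intro j h1 h2
      have := R.m_le l
      omega
    have cb' := cb.mono (K' := K') (by linarith) he0 hε0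
    refine ⟨⟨hx.mono (by linarith) he0 hε0, hr.mono (by linarith) he0 hε0, ?_, ?_, ?_, ?_⟩,
      fun _ => first'⟩ <;> intro j h1 h2 <;> rw [hsl] <;>
      rcases split j h1 h2 with ⟨h3, h4⟩ | h3
    · exact cb'.p j h3 h4
    · rw [h3]; exact hp'
    · exact cb'.q j h3 h4
    · rw [h3]; exact hq'
    · exact cb'.low j h3 h4
    · rw [h3]
      have h4 : 0 ≤ τ * c₀ * e ^ 2 := by positivity
      linarith
    · exact cb'.low' j h3 h4
    · rw [h3]; exact hlow'

end RestartedAM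
end

/-! ### Existence of the local constants. -/

noncomputable section
namespace RestartedAM

section Constants

variable {d : ℕ} {g : Vec d → Vec d} {xs : Vec d}

/-- The quadratic form attains a positive minimum on the compact unit sphere, which is empty for `d
= 0`. -/
theorem exists_coercive (A : Vec d →L[ℝ] Vec d)
    (hA : ∀ y : Vec d, y ≠ 0 → 0 < inner ℝ y (A y)) :
    ∃ μ : ℝ, 0 < μ ∧ ∀ y : Vec d, μ * ‖y‖ ^ 2 ≤ inner ℝ y (A y) := by
  rcases (Metric.sphere (0 : Vec d) 1).eq_empty_or_nonempty with h0 | hne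
  · refine ⟨1, one_pos, fun y => ?_⟩
    by_cases hy : y = 0
    · simp [hy]
    · have : (‖y‖⁻¹ • y) ∈ Metric.sphere (0 : Vec d) 1 := by
        rw [mem_sphere_zero_iff_norm, norm_smul, norm_inv, norm_norm,
          inv_mul_cancel₀ (norm_ne_zero_iff.2 hy)]
      simp [h0] at this
  · have hcont : Continuous fun y : Vec d => (inner ℝ y (A y) : ℝ) := by fun_prop
    obtain ⟨z, hz, hmin⟩ :=
      (isCompact_sphere (0 : Vec d) 1).exists_isMinOn hne hcont.continuousOn
    have hz0 : z ≠ 0 := by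
      rintro rfl
      simp at hz
    refine ⟨inner ℝ z (A z), hA z hz0, fun y => ?_⟩
    by_cases hy : y = 0
    · simp [hy]
    · have hn := norm_ne_zero_iff.2 hy
      have hm : (‖y‖⁻¹ • y) ∈ Metric.sphere (0 : Vec d) 1 := by
        rw [mem_sphere_zero_iff_norm, norm_smul, norm_inv, norm_norm, inv_mul_cancel₀ hn]
      have h1 : inner ℝ z (A z) ≤ (inner ℝ (‖y‖⁻¹ • y) (A (‖y‖⁻¹ • y)) : ℝ) := hmin hm
      rw [map_smul, inner_smul_left, inner_smul_right] at h1
      simp only [conj_trivial] at h1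
      calc inner ℝ z (A z) * ‖y‖ ^ 2
          ≤ (‖y‖⁻¹ * (‖y‖⁻¹ * inner ℝ y (A y))) * ‖y‖ ^ 2 := by gcongr
        _ = inner ℝ y (A y) := by field_simp

theorem Assumption.exists_localConstants (h : Assumption g xs) :
    ∃ ρ κ μ L : ℝ, LocalConstants g xs ρ κ μ L := by
  obtain ⟨U, hU, K, hdiff, hlip⟩ := h.smooth
  obtain ⟨μ, hμ, hco⟩ := exists_coercive _ h.posDef
  obtain ⟨ρ₀, hρ₀, hball⟩ := Metric.nhds_basis_closedBall.mem_iff.1 hU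
  have hK : (0 : ℝ) ≤ K := K.2
  set A := fderiv ℝ (hfun g) xs with hA
  set ρ := min ρ₀ (μ / 2 / (K + 1)) with hρdef
  have hρ : 0 < ρ := by positivity
  have hsub : Metric.closedBall xs ρ ⊆ U :=
    (Metric.closedBall_subset_closedBall (min_le_left _ _)).trans hball
  have hKρ : K * ρ ≤ μ / 2 := by
    calc K * ρ ≤ (K + 1) * (μ / 2 / (K + 1)) := by
          gcongr
          · linarith
          · exact min_le_right _ _
      _ = μ / 2 := by field_simp
  have hlip' : ∀ x ∈ Metric.closedBall xs ρ, ‖fderiv ℝ (hfun g) x - A‖ ≤ K * ‖x - xs‖ := by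
    intro x hx
    simpa [dist_eq_norm] using hlip.dist_le_mul x (hsub hx) xs (mem_of_mem_nhds hU)
  have hnear : ∀ x ∈ Metric.closedBall xs ρ, ‖fderiv ℝ (hfun g) x - A‖ ≤ μ / 2 := by
    intro x hx
    refine (hlip' x hx).trans (le_trans ?_ hKρ)
    gcongr
    exact mem_closedBall_iff_norm.1 hx
  have hquad : ∀ x ∈ Metric.closedBall xs ρ, ∀ y : Vec d,
      μ / 2 * ‖y‖ ^ 2 ≤ inner ℝ y (fderiv ℝ (hfun g) x y) := by
    intro x hx y
    have h1 : inner ℝ y (fderiv ℝ (hfun g) x y) =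
        (inner ℝ y (A y) + inner ℝ y ((fderiv ℝ (hfun g) x - A) y) : ℝ) := by
      rw [← inner_add_right]; simp
    have h2 := abs_real_inner_le_norm y ((fderiv ℝ (hfun g) x - A) y)
    have h3 := (fderiv ℝ (hfun g) x - A).le_of_opNorm_le (hnear x hx) y
    have h4 := mul_le_mul_of_nonneg_left h3 (norm_nonneg y)
    have h5 := (abs_le.1 h2).1
    have h6 := hco y
    rw [h1]
    linarith
  have hup : ∀ x ∈ Metric.closedBall xs ρ, ∀ y : Vec d,
      ‖fderiv ℝ (hfun g) x y‖ ≤ (‖A‖ + μ / 2) * ‖y‖ := by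
    intro x hx y
    refine (fderiv ℝ (hfun g) x).le_of_opNorm_le ?_ y
    have := norm_sub_norm_le (fderiv ℝ (hfun g) x) A
    linarith [hnear x hx]
  -- On this ball the Jacobian moves by at most half the coercivity constant. The `+ 1` keeps κ
  -- positive when `K = 0`.
  refine ⟨ρ, 2 * K + 1, μ / 2, ‖A‖ + μ / 2, hρ, by positivity, by positivity, by positivity,
    fun x hx => hdiff x (hsub hx), ?_, hup, hquad, ?_, ?_⟩
  · intro x hx y
    rcases (norm_nonneg y).eq_or_lt with h0 | h0
    · rw [← h0, mul_zero]; positivity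
    · have h1 := (hquad x hx y).trans (real_inner_le_norm _ _)
      have h2 : ‖y‖ * (μ / 2 * ‖y‖) ≤ ‖y‖ * ‖fderiv ℝ (hfun g) x y‖ := by linarith
      exact le_of_mul_le_mul_left h2 h0
  · intro x hx y
    have h1 := real_inner_le_norm y (fderiv ℝ (hfun g) x y)
    have h2 := mul_le_mul_of_nonneg_left (hup x hx y) (norm_nonneg y)
    linarith
  · intro x hx
    have hx' := mem_closedBall_iff_norm.1 hx
    -- The mean value inequality on the ball through `x` itself makes the remainder quadratic.
    have hsub' : Metric.closedBall xs ‖x - xs‖ ⊆ Metric.closedBall xs ρ :=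
      Metric.closedBall_subset_closedBall hx'
    have h1 := (convex_closedBall xs ‖x - xs‖).norm_image_sub_le_of_norm_fderiv_le'
      (f := hfun g) (φ := A) (C := K * ‖x - xs‖) (x := xs) (y := x) (𝕜 := ℝ)
      (fun z hz => hdiff z (hsub (hsub' hz)))
      (fun z hz => (hlip' z (hsub' hz)).trans (by
        gcongr; exact mem_closedBall_iff_norm.1 hz))
      (Metric.mem_closedBall_self (norm_nonneg _)) (mem_closedBall_iff_norm.2 le_rfl)
    rw [h.zero, sub_zero] at h1
    have : 0 ≤ ‖x - xs‖ ^ 2 := by positivity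
    linarith

end Constants

/-! ### Construction of the sweep model, and its equivalence with Process II. -/

variable {d : ℕ} {ty : AMType} {g : Vec d → Vec d} {mem : ℕ} {τ η : ℝ} {β : ℕ → ℝ}
  {xs : Vec d} {ρ κ μ L : ℝ}

/-- The sequence whose `k`-th term is computed by `F` from the terms before it. -/
def strongFix {α : Type*} [Inhabited α] (F : ℕ → (ℕ → α) → α) (k : ℕ) : α :=
  F k fun j => if _ : j < k then strongFix F j else default
termination_by k

theorem strongFix_eq {α : Type*} [Inhabited α] (F : ℕ → (ℕ → α) → α)
    (hF : ∀ k f f', (∀ j < k, f j = f' j) → F k f = F k f') (k : ℕ) :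
    strongFix F k = F k (strongFix F) := by
  rw [strongFix]
  exact hF k _ _ fun j hj => by simp [hj]

theorem sweepNext_congr (R : ProcessI ty g mem τ η β) {xh xh' ph ph' qh qh' : ℕ → Vec d} (k : ℕ)
    (hx : xh k = xh' k) (hp : ∀ i ≤ k, ph i = ph' i) (hq : ∀ i ≤ k, qh i = qh' i) :
    sweepNext R xs xh ph qh k = sweepNext R xs xh' ph' qh' k := by
  have hm := R.m_le k
  rw [sweepNext, sweepNext, hx, sweep_congr (R.m k)
    (fun i _ h => ty.dir_congr (hp (k - R.m k + i) (by omega)) (hq _ (by omega)))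
    (fun i _ h => hp (k - R.m k + i) (by omega)) (fun i _ h => hq (k - R.m k + i) (by omega))]

/-- The iterate at which iteration `k` of the linear process starts. -/
def modelIterate (R : ProcessI ty g mem τ η β) (xs : Vec d) (k : ℕ) (xh ph qh : ℕ → Vec d) :
    Vec d :=
  if R.m k = 0 then R.x k else sweepNext R xs xh ph qh (k - 1)

/-- The pair `(p, q)` of iteration `k` of the linear process, which starts at `z`. -/
def modelPair (R : ProcessI ty g mem τ η β) (xs : Vec d) (k : ℕ) (z : Vec d)
    (xh ph qh : ℕ → Vec d) : Vec d × Vec d :=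
  if R.m k = 0 then 0 else sweep (ty.dir ph qh) ph qh (k - R.m k) (z - xh (k - 1))
    (linResid g xs z - linResid g xs (xh (k - 1))) (R.m k - 1)

/-- The terms of the linear process in iteration `k`, computed from the earlier ones. -/
def modelRec (R : ProcessI ty g mem τ η β) (xs : Vec d) (k : ℕ)
    (f : ℕ → Vec d × Vec d × Vec d) : Vec d × Vec d × Vec d :=
  let z := modelIterate R xs k (fun j => (f j).1) (fun j => (f j).2.1) (fun j => (f j).2.2)
  (z, modelPair R xs k z (fun j => (f j).1) (fun j => (f j).2.1) (fun j => (f j).2.2))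

theorem modelRec_congr (R : ProcessI ty g mem τ η β) (k : ℕ)
    (f f' : ℕ → Vec d × Vec d × Vec d) (h : ∀ j < k, f j = f' j) :
    modelRec R xs k f = modelRec R xs k f' := by
  have hm := R.m_le k
  have hz : modelIterate R xs k (fun j => (f j).1) (fun j => (f j).2.1) (fun j => (f j).2.2) =
      modelIterate R xs k (fun j => (f' j).1) (fun j => (f' j).2.1) (fun j => (f' j).2.2) := by
    unfold modelIterate
    split_ifs with h0
    · rfl
    · exact sweepNext_congr R (k - 1) (by simp only [h (k - 1) (by omega)])
        (fun i hi => by simp only [h i (by omega)]) (fun i hi => by simp only [h i (by omega)])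
  simp only [modelRec, hz, Prod.mk.injEq, true_and]
  unfold modelPair
  split_ifs with h0
  · rfl
  · have hl := h (k - 1) (by omega)
    beta_reduce
    rw [hl]
    refine sweep_congr _ (fun i _ hi => ty.dir_congr ?_ ?_) (fun i _ hi => ?_) (fun i _ hi => ?_)
      <;> simp only [h (k - R.m k + i) (by omega)]

/-- Sweeps are total, as division by 0 gives 0, so the recursion needs no information on pivots. -/
theorem exists_sweepModel (R : ProcessI ty g mem τ η β) (xs : Vec d) :
    ∃ xh out ph qh : ℕ → Vec d, ∀ N, SweepModel R xs N xh out ph qh := by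
  set f := strongFix (modelRec R xs) with hf
  have hfk : ∀ k, f k = modelRec R xs k f := strongFix_eq _ (modelRec_congr R)
  refine ⟨fun k => (f k).1, fun k => sweepNext R xs (fun j => (f j).1) (fun j => (f j).2.1)
    (fun j => (f j).2.2) (k - 1), fun k => (f k).2.1, fun k => (f k).2.2, fun N => ?_⟩
  have hx : ∀ k, (f k).1 = modelIterate R xs k (fun j => (f j).1) (fun j => (f j).2.1)
      (fun j => (f j).2.2) := fun k => congrArg Prod.fst (hfk k)
  have hpq : ∀ k, (f k).2 = modelPair R xs k (f k).1 (fun j => (f j).1) (fun j => (f j).2.1)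
      (fun j => (f j).2.2) := by
    intro k
    rw [hx k]
    exact congrArg Prod.snd (hfk k)
  refine ⟨fun k _ h => ?_, fun k _ h => ?_, fun k _ h => ?_, fun k _ => rfl⟩
  · exact (hx k).trans (if_pos h)
  · exact (hx k).trans (if_neg h.ne')
  · exact (hpq k).trans (if_neg h.ne')

/-- The projections of iteration `k` of the linear process are well defined. -/
def Regular (R : ProcessI ty g mem τ η β) (ph qh : ℕ → Vec d) (k : ℕ) : Prop :=
  ∀ i, 1 ≤ i → i ≤ R.m k →
    NonDegenerate (ty.dir ph qh (k - R.m k + i)) (ph (k - R.m k + i)) (qh (k - R.m k + i))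

/-- Each earlier pair of the cycle was orthogonalised in an iteration with the same restart index.
-/
theorem triangular_of_orthogonal (R : ProcessI ty g mem τ η β) {ph qh : ℕ → Vec d} {k : ℕ}
    (orth : ∀ l ≤ k, ∀ i, 1 ≤ i → i < R.m l →
      inner ℝ (ty.dir ph qh (l - R.m l + i)) (qh l) = (0 : ℝ)) (i i' : ℕ) (hi : 1 ≤ i)
    (hii' : i < i') (hi' : i' ≤ R.m k) :
    inner ℝ (ty.dir ph qh (k - R.m k + i)) (qh (k - R.m k + i')) = (0 : ℝ) := by
  have hm := R.m_le k
  have h1 := R.m_sub k (R.m k - i') (by omega)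
  have h2 : k - R.m k + i' = k - (R.m k - i') := by omega
  have := orth (k - (R.m k - i')) (by omega) i hi (by omega)
  rwa [show k - (R.m k - i') - R.m (k - (R.m k - i')) = k - R.m k by omega, ← h2] at this

namespace SweepModel

variable {R : ProcessI ty g mem τ η β} {N : ℕ} {xh out ph qh : ℕ → Vec d}

theorem orthogonal (M : SweepModel R xs N xh out ph qh) (reg : ∀ k ≤ N, Regular R ph qh k)
    (k : ℕ) (hk : k ≤ N) : ∀ i, 1 ≤ i → i < R.m k →
      inner ℝ (ty.dir ph qh (k - R.m k + i)) (qh k) = (0 : ℝ) := by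
  induction k using Nat.strong_induction_on with
  | _ k ih =>
    intro i hi him
    have h1 := congrArg Prod.snd (M.pair k hk (by omega))
    simp only at h1
    have hm := R.m_le k
    obtain ⟨l, rfl⟩ : ∃ l, k = l + 1 := ⟨k - 1, by omega⟩
    have hml := R.m_succ (k := l) (by omega)
    have hsl : l + 1 - R.m (l + 1) = l - R.m l := by omega
    rw [h1, hsl, hml, Nat.add_sub_cancel]
    exact inner_sweep_eq_zero (R.m l)
      (triangular_of_orthogonal R fun l' hl' => ih l' (by omega) (by omega))
      (reg l (by omega)) i hi (by omega)

/-- A model up to `N + 1` is required because `out (N + 1)` must be prescribed too. -/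
theorem nonempty_processII (M : SweepModel R xs (N + 1) xh out ph qh)
    (reg : ∀ k ≤ N, Regular R ph qh k) : Nonempty (ProcessII R xs N) := by
  have orth := (M.mono (Nat.le_succ N)).orthogonal reg
  refine ⟨⟨xh, out, ph, qh, fun k hk => M.restart k (by omega), fun k hk => M.cont k (by omega),
    fun k hk h0 => ?_, fun k hk => ?_⟩⟩
  · obtain ⟨ζ, hζ⟩ := exists_sweep_eq_sub_sum (ty.dir ph qh) ph qh (k - R.m k)
      (xh k - xh (k - 1)) (linResid g xs (xh k) - linResid g xs (xh (k - 1)))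
    have h1 := M.pair k (by omega) h0
    rw [hζ, Prod.mk.injEq] at h1
    refine ⟨ζ, h1.1, h1.2, fun j hj => ?_⟩
    rw [Finset.mem_Icc] at hj
    exact orth k hk j hj.1 (by omega)
  · obtain ⟨Γ, hΓ⟩ := exists_sweep_eq_sub_sum (ty.dir ph qh) ph qh (k - R.m k)
      (xh k) (linResid g xs (xh k))
    refine ⟨Γ, fun i hi => ?_, ?_⟩
    · rw [Finset.mem_Icc] at hi
      have := inner_sweep_eq_zero (a := xh k) (b := linResid g xs (xh k)) (R.m k)
        (triangular_of_orthogonal R fun l hl => orth l (by omega)) (reg k hk) i hi.1 hi.2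
      rwa [hΓ] at this
    · rw [M.step k (by omega), sweepNext, hΓ]
      simp only [smul_add, smul_sub, Finset.smul_sum, Finset.sum_add_distrib, smul_comm (β k)]
      abel

end SweepModel

/-- Regularity is only available for sweep models, so the induction alternates: a model up to `n` is
regular at `n`, which makes step `n` and pair `n + 1` sweeps and extends the model. -/
theorem ProcessII.sweepModel {R : ProcessI ty g mem τ η β} {N : ℕ} (S : ProcessII R xs N)
    (reg : ∀ n ≤ N, SweepModel R xs n S.xh S.out S.ph S.qh → Regular R S.ph S.qh n)
    (n : ℕ) (hn : n ≤ N) : SweepModel R xs n S.xh S.out S.ph S.qh ∧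
      S.out (n + 1) = sweepNext R xs S.xh S.ph S.qh n := by
  have orth : ∀ l ≤ N, ∀ i, 1 ≤ i → i < R.m l →
      inner ℝ (ty.dir S.ph S.qh (l - R.m l + i)) (S.qh l) = (0 : ℝ) := by
    intro l hl i h1 h2
    obtain ⟨ζ, -, -, h⟩ := S.pair l hl (by omega)
    exact h i (Finset.mem_Icc.2 ⟨h1, by omega⟩)
  have tri := fun k (hk : k ≤ N) => triangular_of_orthogonal R (k := k) (ph := S.ph) (qh := S.qh)
    fun l hl => orth l (hl.trans hk)
  have next : ∀ n ≤ N, Regular R S.ph S.qh n →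
      S.out (n + 1) = sweepNext R xs S.xh S.ph S.qh n := by
    intro n hn hreg
    obtain ⟨Γ, h1, h2⟩ := S.step n hn
    have h3 := sweep_eq_of_inner_eq_zero (a := S.xh n) (R.m n) (tri n hn) hreg h1
    rw [h2, sweepNext, h3]
    simp only [smul_add, smul_sub, Finset.smul_sum, Finset.sum_add_distrib, smul_comm (β n)]
    abel
  induction n with
  | zero =>
    have M : SweepModel R xs 0 S.xh S.out S.ph S.qh := by
      refine ⟨fun k hk => S.xh_restart k (by omega), fun k hk => S.xh_continue k (by omega),
        fun k hk h0 => ?_, fun k hk => by omega⟩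
      obtain rfl : k = 0 := by omega
      rw [R.m_zero] at h0
      omega
    exact ⟨M, next 0 hn (reg 0 hn M)⟩
  | succ n ih =>
    obtain ⟨M, hout⟩ := ih (by omega)
    have hreg := reg n (by omega) M
    have M' : SweepModel R xs (n + 1) S.xh S.out S.ph S.qh := by
      refine ⟨fun k hk => S.xh_restart k (by omega), fun k hk => S.xh_continue k (by omega),
        fun k hk h0 => ?_, fun k hk => ?_⟩
      · rcases Nat.lt_or_ge n k with h | h
        · obtain rfl : k = n + 1 := by omega
          obtain ⟨ζ, h1, h2, h3⟩ := S.pair (n + 1) hn h0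
          have hml := R.m_succ h0
          have hm := R.m_le n
          have hsl : n + 1 - R.m (n + 1) = n - R.m n := by omega
          rw [h2] at h3
          rw [hsl, hml, Nat.add_sub_cancel, Nat.add_sub_cancel] at h1 h2 h3 ⊢
          rw [h1, h2]
          exact (sweep_eq_of_inner_eq_zero (R.m n) (tri n (by omega)) hreg h3).symm
        · exact M.pair k h h0
      · rcases Nat.lt_or_ge k n with h | h
        · exact M.step k h
        · obtain rfl : k = n := by omega
          exact hout
    exact ⟨M', next (n + 1) hn (reg (n + 1) hn M')⟩

end RestartedAM
end

/-! ### Uniform constants, confinement of the iterates, and the theorem. -/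

noncomputable section
namespace RestartedAM

/-- The comparison of the two processes with constants that serve for every iteration. -/
theorem exists_uniform_bounds (d : ℕ) (ty : AMType) (mem : ℕ) {τ η βlo βhi μ L : ℝ}
    (hτ0 : 0 < τ) (hτ1 : τ < 1) (hβlo : 0 < βlo) (hβhi : 0 < βhi) (hμ : 0 < μ) (hL : 0 < L) :
    ∃ C θ : ℝ, 1 ≤ C ∧ 0 < θ ∧ θ ≤ 1 ∧ ∀ (g : Vec d → Vec d) (xs : Vec d) (ρ κ : ℝ),
      LocalConstants g xs ρ κ μ L → ∀ β : ℕ → ℝ, (∀ k, βlo ≤ |β k| ∧ |β k| ≤ βhi) →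
      ∀ (R : ProcessI ty g mem τ η β) (k : ℕ) (xh out ph qh : ℕ → Vec d),
      SweepModel R xs k xh out ph qh → ‖R.x (k - R.m k) - xs‖ ≤ θ * ρ →
      κ * ‖R.x (k - R.m k) - xs‖ ≤ θ →
      Pert C ‖R.x (k - R.m k) - xs‖ (κ * ‖R.x (k - R.m k) - xs‖)
        (resid g (R.x k)) (linResid g xs (xh k)) ∧
      Pert C ‖R.x (k - R.m k) - xs‖ (κ * ‖R.x (k - R.m k) - xs‖)
        (R.x (k + 1) - xs) (sweepNext R xs xh ph qh k - xs) ∧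
      Regular R ph qh k := by
  have hc : 0 < τ * startConst μ βlo / 4 := by
    have := startConst_pos hμ hβlo
    positivity
  -- Since `m_k ≤ mem`, finitely many pairs of constants are merged, one cycle position at a time.
  suffices H : ∀ n : ℕ, ∃ C θ : ℝ, 1 ≤ C ∧ 0 < θ ∧ θ ≤ 1 ∧
      ∀ (g : Vec d → Vec d) (xs : Vec d) (ρ κ : ℝ),
      LocalConstants g xs ρ κ μ L → ∀ β : ℕ → ℝ, (∀ k, βlo ≤ |β k| ∧ |β k| ≤ βhi) →
      ∀ (R : ProcessI ty g mem τ η β) (k : ℕ) (xh out ph qh : ℕ → Vec d),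
      SweepModel R xs k xh out ph qh → R.m k < n → ‖R.x (k - R.m k) - xs‖ ≤ θ * ρ →
      κ * ‖R.x (k - R.m k) - xs‖ ≤ θ →
      Pert C ‖R.x (k - R.m k) - xs‖ (κ * ‖R.x (k - R.m k) - xs‖)
        (resid g (R.x k)) (linResid g xs (xh k)) ∧
      Pert C ‖R.x (k - R.m k) - xs‖ (κ * ‖R.x (k - R.m k) - xs‖)
        (R.x (k + 1) - xs) (sweepNext R xs xh ph qh k - xs) ∧
      Regular R ph qh k by
    obtain ⟨C, θ, h1, h2, h3, h⟩ := H (mem + 1)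
    exact ⟨C, θ, h1, h2, h3, fun g xs ρ κ hLC β hβ R k xh out ph qh M =>
      h g xs ρ κ hLC β hβ R k xh out ph qh M (Nat.lt_succ_of_le (R.m_le_mem k))⟩
  intro n
  induction n with
  | zero => exact ⟨1, 1, le_rfl, one_pos, le_rfl, fun _ _ _ _ _ _ _ _ _ _ _ _ _ _ h => by omega⟩
  | succ n ih =>
    obtain ⟨C, θ, hC, hθ0, hθ1, ih⟩ := ih
    obtain ⟨K, θ', hK, hθ0', hθ1', hn⟩ :=
      exists_cycleBounds d ty mem (η := η) hτ0 hτ1 hβlo hβhi hμ hL n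
    have hs := one_le_sweepFactor (by linarith : 0 ≤ K) hc
    set F := sweepFactor K (τ * startConst μ βlo / 4) with hF
    set K₁ := K * F ^ n + 2 * βhi * (K * F ^ n) with hK₁
    have hK₁p : 0 < K₁ := by positivity
    refine ⟨C + K + K₁, min θ θ', by linarith, by positivity, (min_le_left _ _).trans hθ1, ?_⟩
    intro g xs ρ κ h β hβ R k xh out ph qh M hm he hκ
    have hkp := h.kappa_pos
    have hρ := h.rho_pos
    have he0 : 0 ≤ ‖R.x (k - R.m k) - xs‖ := norm_nonneg _
    have hε0 : 0 ≤ κ * ‖R.x (k - R.m k) - xs‖ := by positivity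
    rcases Nat.lt_or_ge (R.m k) n with hlt | hge
    · obtain ⟨h1, h2, h3⟩ := ih g xs ρ κ h β hβ R k xh out ph qh M hlt
        (he.trans (by gcongr; exact min_le_left _ _)) (hκ.trans (min_le_left _ _))
      exact ⟨h1.mono (by linarith) he0 hε0, h2.mono (by linarith) he0 hε0, h3⟩
    · have hmn : R.m k = n := by omega
      obtain ⟨cb, -⟩ := hn g xs ρ κ h β hβ R k xh out ph qh M hmn
        (he.trans (by gcongr; exact min_le_right _ _)) (hκ.trans (min_le_right _ _))
      have h2 := cb.next (by linarith) hc he0 hε0 hβhi.le (hβ k).2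
      rw [← hF] at h2
      have h3 : K * F ^ R.m k + 2 * βhi * (K * F ^ R.m k) ≤ C + K + K₁ := by
        rw [hmn, ← hK₁]; linarith
      exact ⟨cb.r.mono (by linarith) he0 hε0, h2.mono h3 he0 hε0, cb.nonDegenerate hc he0⟩

/-- All iterates with residuals comparable to the first one stay close to the solution. -/
theorem ProcessI.norm_sub_le {d : ℕ} {ty : AMType} {g : Vec d → Vec d} {mem : ℕ} {τ η : ℝ}
    {β : ℕ → ℝ} {xs : Vec d} {ρ κ μ L η₀ δ D C : ℝ} (R : ProcessI ty g mem τ η β)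
    (h : LocalConstants g xs ρ κ μ L) (hη₀ : 0 ≤ η₀) (h0 : ‖R.x 0 - xs‖ ≤ δ)
    (hD : δ + 2 / μ * (η₀ * ((L + 1) * δ)) ≤ D) (hDρ : C * D ≤ ρ) (hDκ : C * D ≤ μ / κ)
    (hδρ : δ ≤ ρ) (hδκ : κ * δ ≤ 1) (hC : 0 ≤ C)
    (next : ∀ k, ‖R.x (k - R.m k) - xs‖ ≤ D →
      ‖R.x (k + 1) - xs‖ ≤ C * ‖R.x (k - R.m k) - xs‖) (k : ℕ)
    (hk : ∀ j ≤ k, ‖hfun g (R.x j)‖ ≤ η₀ * ‖hfun g (R.x 0)‖) (j : ℕ) (hj : j ≤ k) :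
    ‖R.x j - xs‖ ≤ D := by
  have hkp := h.kappa_pos
  have hμ := h.mu_pos
  have hL := h.L_pos
  have hδ : 0 ≤ δ := (norm_nonneg _).trans h0
  have hh0 : ‖hfun g (R.x 0)‖ ≤ (L + 1) * δ := by
    refine (h.hfun_le (h0.trans hδρ)).trans ?_
    have h1 : L * ‖R.x 0 - xs‖ ≤ L * δ := by gcongr
    have h2 : 1 / 2 * κ * ‖R.x 0 - xs‖ ^ 2 ≤ 1 / 2 * κ * δ ^ 2 := by gcongr
    have h3 := mul_le_mul_of_nonneg_right hδκ hδ
    linarith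
  have hnn : 0 ≤ 2 / μ * (η₀ * ((L + 1) * δ)) := by positivity
  induction j using Nat.strong_induction_on with
  | _ j ih =>
    rcases j with - | j
    · linarith
    -- Bootstrap: the crude growth bound from the restart point puts the new iterate where `h`
    -- controls the distance; the residual hypothesis then restores the bound `D`.
    · have hs := ih (j - R.m j) (by omega) (by omega)
      have h1 : ‖R.x (j + 1) - xs‖ ≤ C * D := (next j hs).trans (by gcongr)
      have h2 : κ * ‖R.x (j + 1) - xs‖ ≤ μ := by
        have := (le_div_iff₀ hkp).1 (h1.trans hDκ)
        linarith
      have h3 := h.le_hfun (h1.trans hDρ) h2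
      have h4 : μ / 2 * ‖R.x (j + 1) - xs‖ ≤ η₀ * ((L + 1) * δ) :=
        h3.trans ((hk (j + 1) hj).trans (by gcongr))
      have h5 : ‖R.x (j + 1) - xs‖ ≤ 2 / μ * (η₀ * ((L + 1) * δ)) := by
        calc ‖R.x (j + 1) - xs‖ = 2 / μ * (μ / 2 * ‖R.x (j + 1) - xs‖) := by field_simp
          _ ≤ _ := by gcongr
      linarith

end RestartedAM
end

theorem lemma4p1 (d : ℕ) (ty : RestartedAM.AMType) (mem : ℕ) (hmem : 0 < mem)
    (τ η βlo βhi η₀ : ℝ) (hτ0 : 0 < τ) (hτ1 : τ < 1) (hη : 0 < η)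
    (hβlo : 0 < βlo) (hβhi : 0 < βhi) (hη₀ : 0 < η₀) :
    (∀ (g : RestartedAM.Vec d → RestartedAM.Vec d) (xs : RestartedAM.Vec d),
      RestartedAM.Assumption g xs →
      ∃ ρ κ μ L : ℝ, RestartedAM.LocalConstants g xs ρ κ μ L) ∧
    (∀ μ L : ℝ, 0 < μ → 0 < L → ∃ C : ℝ, 0 < C ∧
      ∀ ρ κ : ℝ, 0 < ρ → 0 < κ → ∃ δ : ℝ, 0 < δ ∧
        ∀ (g : RestartedAM.Vec d → RestartedAM.Vec d) (xs : RestartedAM.Vec d),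
          RestartedAM.Assumption g xs → RestartedAM.LocalConstants g xs ρ κ μ L →
          ∀ β : ℕ → ℝ, (∀ k, βlo ≤ |β k| ∧ |β k| ≤ βhi) →
          ∀ R : RestartedAM.ProcessI ty g mem τ η β, ‖R.x 0 - xs‖ ≤ δ →
          ∀ k : ℕ,
            (∀ j ≤ k, ‖RestartedAM.hfun g (R.x j)‖ ≤ η₀ * ‖RestartedAM.hfun g (R.x 0)‖) →
            Nonempty (RestartedAM.ProcessII R xs k) ∧
            ∀ S : RestartedAM.ProcessII R xs k,
              ‖RestartedAM.resid g (R.x k) - RestartedAM.linResid g xs (S.xh k)‖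
                  ≤ C * κ * ‖R.x (k - R.m k) - xs‖ ^ 2 ∧
              ‖R.x (k + 1) - S.out (k + 1)‖
                  ≤ C * κ * ‖R.x (k - R.m k) - xs‖ ^ 2) := by
  refine ⟨fun g xs h => h.exists_localConstants, fun μ L hμ hL => ?_⟩
  obtain ⟨C, θ, hC, hθ0, hθ1, bounds⟩ :=
    RestartedAM.exists_uniform_bounds d ty mem (η := η) hτ0 hτ1 hβlo hβhi hμ hL
  have hC0 : 0 < C := by linarith
  refine ⟨C, hC0, fun ρ κ hρ hκ => ?_⟩
  -- Chosen so that δ = D / C₀ satisfies δ + (2/μ) η₀ (L+1) δ = D.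
  set C₀ := 1 + 2 / μ * (η₀ * (L + 1)) with hC₀
  have hC₀1 : 1 ≤ C₀ := by
    have : 0 ≤ 2 / μ * (η₀ * (L + 1)) := by positivity
    linarith
  -- The first two bounds are the hypotheses of `bounds`; the last two make the crude radius `C * D`
  -- admissible for `LocalConstants.le_hfun`.
  set D := min (min (θ * ρ) (θ / κ)) (min (ρ / C) (μ / κ / C)) with hDdef
  have hD : 0 < D := by positivity
  have hD1 : D ≤ θ * ρ := (min_le_left _ _).trans (min_le_left _ _)
  have hD2 : κ * D ≤ θ := by
    have : D ≤ θ / κ := (min_le_left _ _).trans (min_le_right _ _)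
    rw [le_div_iff₀ hκ] at this
    linarith
  have hD3 : C * D ≤ ρ := by
    have : D ≤ ρ / C := (min_le_right _ _).trans (min_le_left _ _)
    rw [le_div_iff₀ hC0] at this
    linarith
  have hD4 : C * D ≤ μ / κ := by
    have : D ≤ μ / κ / C := (min_le_right _ _).trans (min_le_right _ _)
    rw [le_div_iff₀ hC0] at this
    linarith
  have hδD : D / C₀ ≤ D := div_le_self hD.le hC₀1
  refine ⟨D / C₀, by positivity, fun g xs _ h β hβ R h0 k hk => ?_⟩
  -- This model also serves to confine the nonlinear iterates: their growth bound comes from the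
  -- comparison with it.
  obtain ⟨xh, out, ph, qh, M⟩ := RestartedAM.exists_sweepModel R xs
  have near : ∀ j ≤ k, ‖R.x j - xs‖ ≤ D := by
    refine R.norm_sub_le (C := C) h hη₀.le h0 (le_of_eq ?_) hD3 hD4
      (hδD.trans (hD1.trans (mul_le_of_le_one_left hρ.le hθ1))) ?_ hC0.le (fun l hl => ?_) k hk
    · calc D / C₀ + 2 / μ * (η₀ * ((L + 1) * (D / C₀))) = D / C₀ * C₀ := by rw [hC₀]; ring
        _ = D := by field_simp
    · exact (mul_le_mul_of_nonneg_left hδD hκ.le).trans (hD2.trans hθ1)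
    · exact (bounds g xs ρ κ h β hβ R l xh out ph qh (M l) (hl.trans hD1)
        ((mul_le_mul_of_nonneg_left hl hκ.le).trans hD2)).2.1.left
  have near' : ∀ j ≤ k, ‖R.x (j - R.m j) - xs‖ ≤ D := fun j hj => near _ (by omega)
  have bounds' := fun (j : ℕ) (hj : j ≤ k) (xh out ph qh : ℕ → RestartedAM.Vec d) M =>
    bounds g xs ρ κ h β hβ R j xh out ph qh M ((near' j hj).trans hD1)
      ((mul_le_mul_of_nonneg_left (near' j hj) hκ.le).trans hD2)
  refine ⟨(M (k + 1)).nonempty_processII fun j hj => (bounds' j hj _ _ _ _ (M j)).2.2,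
    fun S => ?_⟩
  obtain ⟨MS, hout⟩ := S.sweepModel (fun j hj MS => (bounds' j hj _ _ _ _ MS).2.2) k le_rfl
  obtain ⟨h1, h2, -⟩ := bounds' k le_rfl _ _ _ _ MS
  have e1 : C * κ * ‖R.x (k - R.m k) - xs‖ ^ 2 =
      C * (κ * ‖R.x (k - R.m k) - xs‖) * ‖R.x (k - R.m k) - xs‖ := by ring
  rw [e1]
  refine ⟨h1.diff, ?_⟩
  have h3 := h2.diff
  rwa [sub_sub_sub_cancel_right, ← hout] at h3
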